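/- Let $b_1,b_2\in\mathbb C$ be nonzero with $b_1b_2^{-1}\notin\mathbb R$, let $B=\operatorname{diag}(b_1,b_2)$, and let $Q=\begin{pmatrix}0&Q_{12}\\Q_{21}&0\end{pmatrix}$, where $Q_{12},Q_{21}:[0,1]\to\mathbb C$ admit analytic continuations to a disc $\{|z|<R\}$ with some $R>1$. Put $\|Q\|_{C[0,1]}:=\max\{\|Q_{12}\|_{C[0,1]},\|Q_{21}\|_{C[0,1]}\}$. Let $d_1,d_2\in\mathbb C\setminus\{0\}$ and write $d_j=e^{-2\pi i\gamma_j}$ with $\gamma_j=\alpha_j+i\beta_j$, $\alpha_j\in[0,1)$, $\beta_j\in\mathbb R$, $j\in\{1,2\}$. Consider the boundary value problem $$-iB^{-1}y'+Q(x)y=\lambda y,\quad x\in[0,1],\qquad y_1(0)=d_1y_1(1),\quad y_2(0)=d_2y_2(1),$$ for $y=(y_1,y_2)^{\top}$. Let $\Phi(\cdot,\lambda)$ be the fundamental matrix of the system with $\Phi(0,\lambda)=I_2$, let $\Delta(\lambda)=\det\bigl(I_2-\operatorname{diag}(d_1,d_2)\,\Phi(1,\lambda)\bigr)$ be the characteristic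 determinant (an entire function whose zeros are the eigenvalues of the problem), and let $\Lambda$ be the sequence of its zeros, counted with multiplicity. A family of complex numbers is called separated if for some $\delta>0$ any two members with different indices are at distance greater than $2\delta$; a family indexed by $(n,j)\in\mathbb Z\times\{1,2\}$ is called asymptotically separated if for some $n_0\in\mathbb N$ its members with $|n|>n_0$ form a separated family. Then: (i) The sequence $\Lambda$ can be ordered as $\Lambda=\{\lambda_{nj}\}_{n\in\mathbb Z,\,j\in\{1,2\}}$ in such a way that $$\lambda_{nj}=2\pi b_j^{-1}(\gamma_j+n)+o(1)\quad\text{as } n\to\infty,\ n\in\mathbb Z,\qquad j\in\{1,2\}$$ (that is, as $|n|\to\infty$). In particular, $\Lambda$ is asymptotically separated. (ii) Let $b_1b_2^{-1}=c_1+ic_2$ with $c_1,c_2\in\mathbb R$, and assume in addition that $$\alpha_1\ne\left\{\frac{c_1\beta_1-(c_1^2+c_2^2)\beta_2}{c_2}\right\}\quad\text{or}\quad\alpha_2\ne\left\{\frac{\beta_1-c_1\beta_2}{c_2}\right\},$$ where $\{x\}$ is the fractional part of $x$. Then there is a constant $C>0$, depending only on $b_1,b_2,d_1,d_2$, such that $\Lambda$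 is separated (in particular, all zeros of $\Delta$ are simple) whenever $\|Q\|_{C[0,1]}<C$. -/

import Mathlib

open Complex Set Filter Topology

noncomputable section

/-- The off-diagonal potential matrix `Q(x)` with entries `q₁₂(x)` and `q₂₁(x)`. -/
def potential (q₁₂ q₂₁ : ℝ → ℂ) (x : ℝ) : Matrix (Fin 2) (Fin 2) ℂ :=
  !![0, q₁₂ x; q₂₁ x, 0]

/-- The function `q` on `[0,1]` admits an analytic continuation to a disc
`{|z| < R}` that contains `[0,1]`. -/
def HasAnalyticContinuation (q : ℝ → ℂ) : Prop :=
  ∃ R : ℝ, 1 < R ∧ ∃ f : ℂ → ℂ, DifferentiableOn ℂ f (Metric.ball 0 R) ∧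
    ∀ x ∈ Icc (0 : ℝ) 1, f (x : ℂ) = q x

/-- The uniform norm of a (continuous) function on `[0,1]`. -/
def supNorm (q : ℝ → ℂ) : ℝ :=
  sSup ((fun x => ‖q x‖) '' Icc (0 : ℝ) 1)

/-- `‖Q‖ = max {‖q₁₂‖, ‖q₂₁‖}` with uniform norms on `[0,1]`. -/
def potentialNorm (q₁₂ q₂₁ : ℝ → ℂ) : ℝ :=
  max (supNorm q₁₂) (supNorm q₂₁)

/-- `Φ` is the fundamental matrix on `[0,1]` of the system `-i B⁻¹ y' + Q(x) y = lam y`,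
`B = diag (b₁, b₂)`, normalized by `Φ(0) = I₂`; here `Q` is continuous, so the solutions are
the classical ones, with one-sided derivatives at the end points. It is unique on `[0,1]`. -/
def IsFundamentalMatrix (b : Fin 2 → ℂ) (q₁₂ q₂₁ : ℝ → ℂ) (lam : ℂ)
    (Φ : ℝ → Matrix (Fin 2) (Fin 2) ℂ) : Prop :=
  Φ 0 = 1 ∧ ∀ x ∈ Icc (0 : ℝ) 1, ∃ Φ' : Matrix (Fin 2) (Fin 2) ℂ,
    (∀ j k, HasDerivWithinAt (fun t => Φ t j k) (Φ' j k) (Icc 0 1) x) ∧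
    (-I) • ((Matrix.diagonal b)⁻¹ * Φ') + potential q₁₂ q₂₁ x * Φ x = lam • Φ x

/-- The fundamental matrix `Φ(·, lam)`. -/
def fundamentalMatrix (b : Fin 2 → ℂ) (q₁₂ q₂₁ : ℝ → ℂ) (lam : ℂ) :
    ℝ → Matrix (Fin 2) (Fin 2) ℂ :=
  Classical.epsilon (IsFundamentalMatrix b q₁₂ q₂₁ lam)

/-- The characteristic determinant `det (C + D Φ(1, lam))` of the boundary value problem
with boundary conditions `C y(0) + D y(1) = 0`. -/
def characteristicDet (b : Fin 2 → ℂ) (q₁₂ q₂₁ : ℝ → ℂ) (C D : Matrix (Fin 2) (Fin 2) ℂ)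
    (lam : ℂ) : ℂ :=
  (C + D * fundamentalMatrix b q₁₂ q₂₁ lam 1).det

/-- The characteristic determinant for the quasi-periodic boundary conditions
`y₁(0) - d₁ y₁(1) = 0`, `y₂(0) - d₂ y₂(1) = 0`. -/
def quasiPeriodicDet (b d : Fin 2 → ℂ) (q₁₂ q₂₁ : ℝ → ℂ) (lam : ℂ) : ℂ :=
  characteristicDet b q₁₂ q₂₁ 1 (-Matrix.diagonal d) lam

/-- `l` lists all zeros of the entire function `F`, each one as many times as its
multiplicity. -/
def IsZeroSequence {ι : Type*} (F : ℂ → ℂ) (l : ι → ℂ) : Prop :=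
  Differentiable ℂ F ∧ ∀ z : ℂ, {p | l p = z}.encard = analyticOrderAt F z

/-- A family of complex numbers is separated: distinct indices carry numbers at distance
greater than a fixed `2δ > 0`. -/
def IsSeparatedFamily {ι : Type*} (l : ι → ℂ) : Prop :=
  ∃ δ : ℝ, 0 < δ ∧ ∀ p q : ι, p ≠ q → 2 * δ < ‖l p - l q‖

/-- The family `l n j` becomes separated after the removal of the finitely many entries
with `|n| ≤ n₀`, for some `n₀`. -/
def IsAsymptoticallySeparated (l : ℤ × Fin 2 → ℂ) : Prop :=
  ∃ n₀ : ℕ, IsSeparatedFamily (fun p : {p : ℤ × Fin 2 // (n₀ : ℤ) < |p.1|} => l p)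

/-- The zeros `2 π b_j⁻¹ (γ_j + n)` of the unperturbed characteristic determinant. -/
def unperturbedZero (b γ : Fin 2 → ℂ) (p : ℤ × Fin 2) : ℂ :=
  2 * Real.pi * (b p.2)⁻¹ * (γ p.2 + p.1)

/-- The condition under which the unperturbed zeros are separated, with
`b₁ / b₂ = c₁ + i c₂` and `γ_j = α_j + i β_j`. -/
def SeparationCondition (b γ : Fin 2 → ℂ) : Prop :=
  let c₁ := (b 0 * (b 1)⁻¹).re
  let c₂ := (b 0 * (b 1)⁻¹).im
  (γ 0).re ≠ Int.fract ((c₁ * (γ 0).im - (c₁ ^ 2 + c₂ ^ 2) * (γ 1).im) / c₂) ∨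
    (γ 1).re ≠ Int.fract (((γ 0).im - c₁ * (γ 1).im) / c₂)

end

/-! The problem is compared with the one for `Q = 0`, whose determinant is `(1 - d₁ e^{i b₁ λ}) (1 -
d₂ e^{i b₂ λ})` and whose zeros form two arithmetic progressions with steps `2π / b_j`. Since `b₁ /
b₂` is not real, the steps are linearly independent over the reals. Hence points of different
progressions are far apart as soon as one index is large, and only finitely many pairs can coincide
(`exists_eventually_separated_unperturbedZero`).

For these boundary conditions the off-diagonal entries of `Φ(1, λ)` enter `Δ` only through `det Φ(1,
λ)`, and by Liouville's formula this is `e^{i (b₁ + b₂) λ}` for every `Q`. So `Δ` differs from the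
unperturbed determinant only by the errors of the two diagonal entries. After division by the
dominant exponential the system reads `p' = a r`, `r' = μ r + c p` with `Re μ ≤ 0`. An energy
estimate and Duhamel's formula bound the errors by `const * ρ * max |e^{i b_j λ}|`
(`norm_quasiPeriodicDet_sub_le`). Here `ρ` can be `O(1 / |λ|)`, by integration by parts, or `M e^M`,
where `M` bounds `B Q`, uniformly in `λ`.

Off discs of fixed radius about its zeros, the unperturbed determinant is at least `c * max |e^{i
b_j λ}|` (`exists_le_norm_unperturbedDet`), the same growth as the error, so Rouché's theorem
applies. With the first `ρ` it is used on one large circle and on small circles about all remaining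
zeros; shrinking the latter gives the asymptotics. With the second `ρ` and small `Q` it is used on
equal discs about all zeros, which the extra condition makes uniformly separated. -/

/-! ### Factoring the zeros out of an entire function -/

theorem Differentiable.exists_eq_sub_mul {f : ℂ → ℂ} (hf : Differentiable ℂ f) {a : ℂ}
    (ha : f a = 0) : ∃ g : ℂ → ℂ, Differentiable ℂ g ∧ ∀ z, f z = (z - a) * g z := by
  refine ⟨dslope f a, ?_, fun z => ?_⟩
  · rw [← differentiableOn_univ, Complex.differentiableOn_dslope univ_mem, differentiableOn_univ]
    exact hf
  · have := sub_smul_dslope f a z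
    simpa [ha] using this.symm

theorem Differentiable.analyticOrderAt_ne_top {f : ℂ → ℂ} (hf : Differentiable ℂ f) {w : ℂ}
    (hw : f w ≠ 0) (z : ℂ) : analyticOrderAt f z ≠ ⊤ := by
  have hA : AnalyticOnNhd ℂ f univ := fun z _ => hf.analyticAt z
  refine hA.analyticOrderAt_ne_top_of_isPreconnected isPreconnected_univ (mem_univ w) (mem_univ z) ?_
  rw [(hf.analyticAt w).analyticOrderAt_eq_zero.2 hw]
  simp

theorem Differentiable.exists_eq_pow_mul {f : ℂ → ℂ} (hf : Differentiable ℂ f) {w : ℂ}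
    (hw : f w ≠ 0) (a : ℂ) :
    ∃ (n : ℕ) (g : ℂ → ℂ), Differentiable ℂ g ∧ g a ≠ 0 ∧ ∀ z, f z = (z - a) ^ n * g z := by
  obtain ⟨n, hn⟩ := ENat.ne_top_iff_exists.1 (hf.analyticOrderAt_ne_top hw a)
  induction n generalizing f with
  | zero =>
    refine ⟨0, f, hf, ?_, by simp⟩
    exact (hf.analyticAt a).analyticOrderAt_eq_zero.1 (by simpa using hn.symm)
  | succ n ih =>
    have h0 : f a = 0 := by
      apply apply_eq_zero_of_analyticOrderAt_ne_zero (𝕜 := ℂ)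
      rw [← hn]; simp
    obtain ⟨g, hg, hfg⟩ := hf.exists_eq_sub_mul h0
    have hgw : g w ≠ 0 := fun h => hw (by rw [hfg, h, mul_zero])
    have hord : (n : ℕ∞) = analyticOrderAt g a := by
      have h1 : f = (fun z => z - a) * g := funext hfg
      have h2 : analyticOrderAt f a = 1 + analyticOrderAt g a := by
        rw [h1, analyticOrderAt_mul (by fun_prop) (hg.analyticAt a)]
        simp
      rw [← hn, add_comm] at h2
      push_cast at h2
      exact (ENat.add_left_injective_of_ne_top (n := 1) (by simp)) (by simpa [add_comm] using h2)
    obtain ⟨m, k, hk, hka, hgk⟩ := ih hg hgw hord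
    exact ⟨m + 1, k, hk, hka, fun z => by rw [hfg, hgk]; ring⟩

/-- By the identity theorem the zeros in the closed disc are finite in number; dividing out one of
them with its full multiplicity lowers the number of distinct zeros, which drives the induction. -/
theorem Differentiable.exists_factorization_ball {f : ℂ → ℂ} (hf : Differentiable ℂ f) {c : ℂ}
    {R : ℝ} (hR : 0 < R) (h0 : ∀ z ∈ Metric.sphere c R, f z ≠ 0) :
    ∃ (s : Multiset ℂ) (g : ℂ → ℂ), (∀ a ∈ s, a ∈ Metric.ball c R) ∧ Differentiable ℂ g ∧
      (∀ z ∈ Metric.closedBall c R, g z ≠ 0) ∧ ∀ z, f z = (s.map (fun a => z - a)).prod * g z := by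
  obtain ⟨w, hw⟩ : (Metric.sphere c R).Nonempty := NormedSpace.sphere_nonempty.2 hR.le
  have hfin : {z ∈ Metric.closedBall c R | f z = 0}.Finite := by
    by_contra hinf
    obtain ⟨z, hz, hacc⟩ := Set.Infinite.exists_accPt_of_subset_isCompact hinf
      (isCompact_closedBall c R) (fun z hz => hz.1)
    have hA : AnalyticOnNhd ℂ f univ := fun z _ => hf.analyticAt z
    have := hA.eqOn_zero_of_preconnected_of_frequently_eq_zero isPreconnected_univ (mem_univ z)
      ((accPt_iff_frequently_nhdsNE.1 hacc).mono fun y hy => hy.2)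
    exact h0 w hw (this (mem_univ w))
  induction hn : hfin.toFinset.card using Nat.strong_induction_on generalizing f with
  | _ n ih =>
  by_cases hz : ∃ a ∈ Metric.closedBall c R, f a = 0
  · obtain ⟨a, ha, hfa⟩ := hz
    have hab : a ∈ Metric.ball c R := by
      rcases (Metric.mem_closedBall.1 ha).lt_or_eq with h | h
      · exact h
      · exact absurd hfa (h0 a h)
    obtain ⟨k, g, hg, hga, hfg⟩ := hf.exists_eq_pow_mul (h0 w hw) a
    have hsub : ∀ z, g z = 0 → f z = 0 := fun z hz => by rw [hfg, hz, mul_zero]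
    have hgfin : {z ∈ Metric.closedBall c R | g z = 0}.Finite :=
      hfin.subset fun z hz => ⟨hz.1, hsub z hz.2⟩
    have hlt : hgfin.toFinset.card < n := by
      rw [← hn]
      refine Finset.card_lt_card (Finset.ssubset_iff_of_subset ?_ |>.2 ⟨a, ?_, ?_⟩)
      · intro z; simp only [Finite.mem_toFinset]; exact fun hz => ⟨hz.1, hsub z hz.2⟩
      · simpa using ⟨ha, hfa⟩
      · simp [hga]
    obtain ⟨s, q, hs, hq, hq0, hgq⟩ := ih _ hlt hg (fun z hz h => h0 z hz (hsub z h)) hgfin rfl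
    refine ⟨Multiset.replicate k a + s, q, ?_, hq, hq0, fun z => ?_⟩
    · intro b hb
      rcases Multiset.mem_add.1 hb with h | h
      · rw [Multiset.eq_of_mem_replicate h]; exact hab
      · exact hs b h
    · rw [hfg, hgq]; simp; ring
  · push Not at hz
    exact ⟨0, f, by simp, hf, hz, by simp⟩

theorem Multiset.analyticOrderAt_prod_sub (s : Multiset ℂ) (z : ℂ) :
    analyticOrderAt (fun x => (s.map (fun a => x - a)).prod) z = s.count z ∧
      AnalyticAt ℂ (fun x => (s.map (fun a => x - a)).prod) z := by
  induction s using Multiset.induction_on with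
  | empty =>
    have h : AnalyticAt ℂ (fun _ : ℂ => (1 : ℂ)) z := analyticAt_const
    simp only [Multiset.map_zero, Multiset.prod_zero, Multiset.count_zero]
    exact ⟨h.analyticOrderAt_eq_zero.2 one_ne_zero, h⟩
  | cons a s ih =>
    have h : (fun x => ((a ::ₘ s).map (fun a => x - a)).prod)
        = (fun x => x - a) * (fun x => (s.map (fun a => x - a)).prod) := by
      ext x; simp
    have h1 : AnalyticAt ℂ (fun x => x - a) z := by fun_prop
    rw [h]
    refine ⟨?_, h1.mul ih.2⟩
    rw [analyticOrderAt_mul h1 ih.2, ih.1]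
    by_cases hz : z = a
    · subst hz; simp [add_comm]
    · rw [analyticOrderAt_id_sub_const_of_ne hz, Multiset.count_cons_of_ne hz]; simp

theorem analyticOrderAt_eq_count_of_factorization {f g : ℂ → ℂ} {s : Multiset ℂ} {z : ℂ}
    (hg : Differentiable ℂ g) (hgz : g z ≠ 0)
    (hfg : ∀ z, f z = (s.map (fun a => z - a)).prod * g z) :
    analyticOrderAt f z = s.count z := by
  have h : f = (fun x => (s.map (fun a => x - a)).prod) * g := funext hfg
  rw [h, analyticOrderAt_mul (s.analyticOrderAt_prod_sub z).2 (hg.analyticAt z),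
    (s.analyticOrderAt_prod_sub z).1, (hg.analyticAt z).analyticOrderAt_eq_zero.2 hgz, add_zero]

/-! ### Argument principle, Rouché's theorem, perturbation of zeros -/

/-- The logarithmic derivative turns the product into a sum: each linear factor contributes `2πi`,
and the zero-free factor contributes nothing by Cauchy's theorem. -/
theorem circleIntegral_logDeriv_eq_card {f g : ℂ → ℂ} {s : Multiset ℂ} {c : ℂ} {R : ℝ}
    (hR : 0 < R) (hs : ∀ a ∈ s, a ∈ Metric.ball c R) (hg : Differentiable ℂ g)
    (hg0 : ∀ z ∈ Metric.closedBall c R, g z ≠ 0)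
    (hfg : ∀ z, f z = (s.map (fun a => z - a)).prod * g z) :
    CircleIntegrable (fun z => deriv f z / f z) c R ∧
      (∮ z in C(c, R), deriv f z / f z) = 2 * Real.pi * I * s.card := by
  induction s using Multiset.induction_on generalizing f with
  | empty =>
    have hf : f = g := by ext z; simpa using hfg z
    subst hf
    have hd : DifferentiableOn ℂ (fun z => deriv f z / f z) (Metric.closedBall c R) :=
      fun z hz => ((hg.deriv z).div (hg z) (hg0 z hz)).differentiableWithinAt
    refine ⟨(hd.continuousOn.mono Metric.sphere_subset_closedBall).circleIntegrable hR.le, ?_⟩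
    rw [(hd.mono Metric.closure_ball_subset_closedBall).diffContOnCl.circleIntegral_eq_zero hR.le]
    simp
  | cons a s ih =>
    obtain ⟨hi, he⟩ := ih (f := fun z => (s.map (fun a => z - a)).prod * g z)
      (fun b hb => hs b (Multiset.mem_cons_of_mem hb)) (fun z => rfl)
    set k : ℂ → ℂ := fun z => (s.map (fun a => z - a)).prod * g z with hk
    have hkd : Differentiable ℂ k := fun z =>
      (s.analyticOrderAt_prod_sub z).2.differentiableAt.mul (hg z)
    have hf : f = fun z => (z - a) * k z := by
      ext z; rw [hfg, hk]; simp [mul_assoc]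
    have ha : a ∈ Metric.ball c R := hs a (Multiset.mem_cons_self a s)
    have hk0 : ∀ z ∈ Metric.sphere c R, k z ≠ 0 := by
      intro z hz
      refine mul_ne_zero (Multiset.prod_ne_zero fun h => ?_) (hg0 z (Metric.sphere_subset_closedBall hz))
      obtain ⟨b, hb, hzb⟩ := Multiset.mem_map.1 h
      have := hs b (Multiset.mem_cons_of_mem hb)
      rw [← sub_eq_zero.1 hzb] at this
      exact (Metric.mem_ball.1 this).ne (Metric.mem_sphere.1 hz)
    have hza : ∀ z ∈ Metric.sphere c R, z - a ≠ 0 := by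
      intro z hz h
      rw [← sub_eq_zero.1 h] at ha
      exact (Metric.mem_ball.1 ha).ne (Metric.mem_sphere.1 hz)
    have heq : EqOn (fun z => deriv f z / f z) (fun z => (z - a)⁻¹ + deriv k z / k z)
        (Metric.sphere c R) := by
      intro z hz
      have : HasDerivAt f (1 * k z + (z - a) * deriv k z) z := by
        rw [hf]; exact ((hasDerivAt_id z).sub_const a).mul (hkd z).hasDerivAt
      have h1 := hk0 z hz
      have h2 := hza z hz
      have h3 : f z = (z - a) * k z := congrFun hf z
      simp only [this.deriv, h3]
      field_simp
    have hinv : CircleIntegrable (fun z => (z - a)⁻¹) c R :=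
      ContinuousOn.circleIntegrable hR.le fun z hz =>
        (((continuous_id.sub continuous_const).continuousAt).inv₀ (hza z hz)).continuousWithinAt
    constructor
    · exact (CircleIntegrable.add hinv hi).congr_codiscreteWithin
        (by filter_upwards [self_mem_codiscreteWithin _] with z hz
            rw [abs_of_pos hR] at hz; exact (heq hz).symm)
    · rw [circleIntegral.integral_congr hR.le heq, circleIntegral.integral_add hinv hi, he,
        circleIntegral.integral_sub_inv_of_mem_ball ha, Multiset.card_cons]
      push_cast; ring

theorem card_eq_of_norm_sub_lt {f F g G : ℂ → ℂ} {s t : Multiset ℂ} {c : ℂ} {R : ℝ} (hR : 0 < R)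
    (hf : Differentiable ℂ f) (hF : Differentiable ℂ F)
    (hlt : ∀ z ∈ Metric.sphere c R, ‖F z - f z‖ < ‖f z‖)
    (hs : ∀ a ∈ s, a ∈ Metric.ball c R) (hg : Differentiable ℂ g)
    (hg0 : ∀ z ∈ Metric.closedBall c R, g z ≠ 0)
    (hfg : ∀ z, f z = (s.map (fun a => z - a)).prod * g z)
    (ht : ∀ a ∈ t, a ∈ Metric.ball c R) (hG : Differentiable ℂ G)
    (hG0 : ∀ z ∈ Metric.closedBall c R, G z ≠ 0)
    (hFG : ∀ z, F z = (t.map (fun a => z - a)).prod * G z) : s.card = t.card := by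
  obtain ⟨i1, e1⟩ := circleIntegral_logDeriv_eq_card hR hs hg hg0 hfg
  obtain ⟨i2, e2⟩ := circleIntegral_logDeriv_eq_card hR ht hG hG0 hFG
  -- On the circle `F / f` stays in the disc of radius 1 about 1, so its principal logarithm is a
  -- single-valued primitive of the difference of the logarithmic derivatives.
  have hz : (∮ z in C(c, R), (deriv F z / F z - deriv f z / f z)) = 0 := by
    refine circleIntegral.integral_eq_zero_of_hasDerivWithinAt hR.le
      (f := fun z => Complex.log (F z / f z)) fun z hz => ?_
    have h := hlt z hz
    have hfz : f z ≠ 0 := fun h0 => by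
      rw [h0, norm_zero] at h; exact absurd h (norm_nonneg _).not_gt
    have hFz : F z ≠ 0 := fun h0 => by
      rw [h0, zero_sub, norm_neg] at h; exact lt_irrefl _ h
    have hmem : F z / f z ∈ slitPlane := by
      have : F z / f z = 1 + (F z - f z) / f z := by field_simp; ring
      rw [this]
      refine mem_slitPlane_of_norm_lt_one ?_
      rw [norm_div, div_lt_one (norm_pos_iff.2 hfz)]
      exact h
    have hd := (((hF z).hasDerivAt.div (hf z).hasDerivAt hfz).clog hmem).hasDerivWithinAt
      (s := Metric.sphere c R)
    refine hd.congr_deriv ?_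
    simp only [Pi.div_apply]
    field_simp
  rw [circleIntegral.integral_sub i2 i1, e1, e2, sub_eq_zero] at hz
  have h2 : (2 * Real.pi * I : ℂ) ≠ 0 := by simp [Real.pi_ne_zero]
  exact (Nat.cast_injective (R := ℂ) (mul_left_cancel₀ h2 hz)).symm

/-- **Rouché's theorem**, for a function whose zeros are listed with multiplicity. -/
theorem IsZeroSequence.exists_zeros_of_norm_sub_lt {ι : Type*} {f F : ℂ → ℂ} {l : ι → ℂ}
    (hl : IsZeroSequence f l) (hF : Differentiable ℂ F) {c : ℂ} {R : ℝ} (hR : 0 < R)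
    (hlt : ∀ z ∈ Metric.sphere c R, ‖F z - f z‖ < ‖f z‖) {P : Finset ι}
    (hP : ∀ p, p ∈ P ↔ l p ∈ Metric.ball c R) :
    ∃ m : ι → ℂ, (∀ p ∈ P, m p ∈ Metric.ball c R) ∧
      ∀ z ∈ Metric.ball c R, analyticOrderAt F z = {p | p ∈ P ∧ m p = z}.encard := by
  classical
  have hf0 : ∀ z ∈ Metric.sphere c R, f z ≠ 0 := fun z hz h0 => by
    have h := hlt z hz
    rw [h0, norm_zero] at h; exact absurd h (norm_nonneg _).not_gt
  have hF0 : ∀ z ∈ Metric.sphere c R, F z ≠ 0 := fun z hz h0 => by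
    have h := hlt z hz
    rw [h0, zero_sub, norm_neg] at h; exact lt_irrefl _ h
  obtain ⟨s, g, hs, hg, hg0, hfg⟩ := hl.1.exists_factorization_ball hR hf0
  obtain ⟨t, G, ht, hG, hG0, hFG⟩ := hF.exists_factorization_ball hR hF0
  have hcard := card_eq_of_norm_sub_lt hR hl.1 hF hlt hs hg hg0 hfg ht hG hG0 hFG
  -- In the disc both multisets count each point by the order of `f` there.
  have hsP : s = P.val.map l := by
    ext z
    by_cases hz : z ∈ Metric.ball c R
    · have h1 := analyticOrderAt_eq_count_of_factorization hg
        (hg0 z (Metric.ball_subset_closedBall hz)) hfg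
      rw [← hl.2 z] at h1
      have h2 : {p | l p = z} = ((P.filter fun p => z = l p : Finset ι) : Set ι) := by
        ext p
        simp only [mem_ofPred_eq, Finset.coe_filter, hP]
        exact ⟨fun h => ⟨h ▸ hz, h.symm⟩, fun h => h.2.symm⟩
      rw [h2, Set.encard_coe_eq_coe_finsetCard] at h1
      rw [Multiset.count_map]
      exact (Nat.cast_injective h1).symm
    · rw [Multiset.count_eq_zero_of_notMem fun h => hz (hs z h),
        Multiset.count_eq_zero_of_notMem fun h => ?_]
      obtain ⟨p, hp, rfl⟩ := Multiset.mem_map.1 h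
      exact hz ((hP p).1 hp)
  have hPt : P.card = t.toList.length := by
    rw [Multiset.length_toList, ← hcard, hsP, Multiset.card_map]; rfl
  let e : P ≃ Fin t.toList.length := P.equivFinOfCardEq hPt
  -- The zeros of `F` are as many as the elements of `P`, so `P` can index them; the value 0 off `P`
  -- is never counted.
  refine ⟨fun p => if h : p ∈ P then t.toList.get (e ⟨p, h⟩) else 0, fun p hp => ?_, fun z hz => ?_⟩
  · simp only [hp, dif_pos]
    exact ht _ (Multiset.mem_toList.1 (List.get_mem _ _))
  · rw [analyticOrderAt_eq_count_of_factorization hG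
      (hG0 z (Metric.ball_subset_closedBall hz)) hFG]
    have h1 : Multiset.count z t = (Finset.univ.filter fun i => t.toList.get i = z).card := by
      have : t = (Finset.univ : Finset (Fin t.toList.length)).val.map t.toList.get := by
        rw [Fin.univ_val_map, List.ofFn_get, Multiset.coe_toList]
      conv_lhs => rw [this, Multiset.count_map]
      simp only [eq_comm]
      rfl
    rw [h1, ← Set.encard_coe_eq_coe_finsetCard]
    refine (Set.InjOn.encard_image (f := fun i => ((e.symm i : P) : ι)) ?_).symm.trans ?_
    · intro i _ j _ h; exact e.symm.injective (Subtype.ext h)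
    · congr 1
      ext p
      simp only [mem_image, Finset.coe_filter, Finset.mem_univ, true_and, mem_ofPred_eq]
      constructor
      · rintro ⟨i, hi, rfl⟩
        simpa using hi
      · rintro ⟨hp, h⟩
        refine ⟨e ⟨p, hp⟩, ?_, by simp⟩
        simpa [hp] using h

/-- Rouché's theorem in a disc around an isolated entry of the zero sequence. -/
theorem IsZeroSequence.exists_simple_zero_of_norm_sub_lt {ι : Type*} {f F : ℂ → ℂ} {l : ι → ℂ}
    (hl : IsZeroSequence f l) (hF : Differentiable ℂ F) {p : ι} {ε : ℝ} (hε : 0 < ε)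
    (hiso : ∀ q, p ≠ q → ε ≤ ‖l p - l q‖)
    (hlt : ∀ z ∈ Metric.sphere (l p) ε, ‖F z - f z‖ < ‖f z‖) :
    ∃ w ∈ Metric.ball (l p) ε, ∀ z ∈ Metric.ball (l p) ε,
      analyticOrderAt F z = if w = z then 1 else 0 := by
  obtain ⟨m, hm, hm'⟩ := hl.exists_zeros_of_norm_sub_lt hF hε hlt (P := {p}) (fun q => by
    simp only [Finset.mem_singleton, mem_ball_iff_norm]
    refine ⟨fun h => by simp [h, hε], fun h => ?_⟩
    by_contra hne
    have := hiso q (Ne.symm hne)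
    rw [norm_sub_rev] at this
    linarith)
  refine ⟨m p, hm p (by simp), fun z hz => ?_⟩
  rw [hm' z hz]
  split_ifs with h
  · have : {q | q ∈ ({p} : Finset ι) ∧ m q = z} = {p} := by
      ext q; simp only [Finset.mem_singleton, mem_ofPred_eq, mem_singleton_iff]
      exact ⟨fun h => h.1, fun h' => ⟨h', h' ▸ h⟩⟩
    rw [this, encard_singleton]
  · have : {q | q ∈ ({p} : Finset ι) ∧ m q = z} = ∅ := by
      ext q; simp only [Finset.mem_singleton, mem_ofPred_eq, mem_empty_iff_false, iff_false]
      rintro ⟨rfl, h'⟩; exact h h'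
    rw [this, encard_empty]

/-- Zeros of an entire function that is dominated by another one off small discs around the
zeros of the latter. -/
theorem IsZeroSequence.exists_perturbation {ι : Type*} {f F : ℂ → ℂ} {l₀ : ι → ℂ}
    (hl : IsZeroSequence f l₀) (hF : Differentiable ℂ F)
    (htend : Tendsto (fun p => ‖l₀ p‖) cofinite atTop)
    {δ T₀ : ℝ} (hδ : 0 < δ) (hsep : ∀ p q, p ≠ q → T₀ ≤ ‖l₀ p‖ → 2 * δ ≤ ‖l₀ p - l₀ q‖)
    (hgap : ∀ T : ℝ, ∃ R, T ≤ R ∧ ∀ p, δ ≤ |‖l₀ p‖ - R|)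
    (hdom : ∀ ε > 0, ∃ T : ℝ, ∀ z : ℂ, T ≤ ‖z‖ → (∀ p, ε ≤ ‖z - l₀ p‖) →
      ‖F z - f z‖ < ‖f z‖) :
    ∃ l : ι → ℂ, IsZeroSequence F l ∧ Tendsto (fun p => l p - l₀ p) cofinite (𝓝 0) := by
  classical
  obtain ⟨T₁, hT₁⟩ := hdom δ hδ
  -- A circle of radius `R` at distance at least `δ` from every `l₀ p`. Inside it only the number of
  -- zeros is compared; outside it each `l₀ p` is isolated and attracts exactly one simple zero.
  obtain ⟨R, hR, hRgap⟩ := hgap (max 1 (max T₀ T₁))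
  have hR1 : 0 < R := by linarith [le_max_left 1 (max T₀ T₁)]
  have hRT₀ : T₀ ≤ R := ((le_max_left _ _).trans (le_max_right _ _)).trans hR
  have hRT₁ : T₁ ≤ R := ((le_max_right _ _).trans (le_max_right _ _)).trans hR
  have hfin : {p | ‖l₀ p‖ < R}.Finite := by
    have := htend.eventually (eventually_ge_atTop R)
    rw [eventually_cofinite] at this
    simpa using this
  have hfar : ∀ p, ¬ ‖l₀ p‖ < R → R + δ ≤ ‖l₀ p‖ := by
    intro p hp
    have h1 := hRgap p
    rw [abs_of_nonneg (by linarith)] at h1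
    linarith
  have hnear : ∀ p, ‖l₀ p‖ < R → ‖l₀ p‖ ≤ R - δ := by
    intro p hp
    have h1 := hRgap p
    rw [abs_of_neg (by linarith)] at h1
    linarith
  have hdist : ∀ (z : ℂ) p, R ≤ ‖z‖ → ‖l₀ p‖ < R → δ ≤ ‖z - l₀ p‖ := by
    intro z p hz hp
    linarith [norm_sub_norm_le z (l₀ p), hnear p hp]
  -- zeros in the large disc
  obtain ⟨m₀, hm₀, hm₀'⟩ := hl.exists_zeros_of_norm_sub_lt hF (c := 0) hR1
    (fun z hz => by
      have hz' : ‖z‖ = R := by simpa using hz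
      refine hT₁ z (by linarith) fun p => ?_
      by_cases hp : ‖l₀ p‖ < R
      · exact hdist z p hz'.ge hp
      · linarith [norm_sub_norm_le (l₀ p) z, hfar p hp, norm_sub_rev z (l₀ p)])
    (P := hfin.toFinset) (fun p => by simp)
  -- zeros in small discs
  have hsmall : ∀ p, ¬ ‖l₀ p‖ < R → ∀ ε, 0 < ε → ε ≤ δ →
      (∀ z ∈ Metric.sphere (l₀ p) ε, ‖F z - f z‖ < ‖f z‖) →
      ∃ w ∈ Metric.ball (l₀ p) ε, ∀ z ∈ Metric.ball (l₀ p) ε,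
        analyticOrderAt F z = if w = z then 1 else 0 := by
    intro p hp ε hε hεδ hlt
    exact hl.exists_simple_zero_of_norm_sub_lt hF hε (fun q hq => by
      linarith [hsep p q hq (by linarith [hfar p hp])]) hlt
  have hother : ∀ p, ¬ ‖l₀ p‖ < R → ∀ ε, 0 < ε → ε ≤ δ → ∀ z ∈ Metric.sphere (l₀ p) ε,
      ∀ q, ε ≤ ‖z - l₀ q‖ := by
    intro p hp ε hε hεδ z hz q
    rw [mem_sphere_iff_norm] at hz
    by_cases hqp : q = p
    · rw [hqp, hz]
    · have h1 := hsep p q (Ne.symm hqp) (by linarith [hfar p hp])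
      have h2 : ‖l₀ p - l₀ q‖ ≤ ‖z - l₀ p‖ + ‖z - l₀ q‖ := by
        rw [norm_sub_rev z]
        exact (norm_sub_le_norm_sub_add_norm_sub _ z _)
      linarith
  have hzero : ∀ p, ¬ ‖l₀ p‖ < R → ∃ w ∈ Metric.ball (l₀ p) δ, ∀ z ∈ Metric.ball (l₀ p) δ,
        analyticOrderAt F z = if w = z then 1 else 0 := by
    intro p hp
    refine hsmall p hp δ hδ le_rfl fun z hz => hT₁ z ?_ (hother p hp δ hδ le_rfl z hz)
    have h1 := norm_sub_norm_le (l₀ p) z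
    rw [norm_sub_rev, mem_sphere_iff_norm.1 hz] at h1
    linarith [hfar p hp]
  choose! w hw hw' using hzero
  have hwR : ∀ p, ¬ ‖l₀ p‖ < R → R < ‖w p‖ := by
    intro p hp
    have h1 := norm_sub_norm_le (l₀ p) (w p)
    have h2 := mem_ball_iff_norm.1 (hw p hp)
    rw [norm_sub_rev] at h2
    linarith [hfar p hp]
  let l : ι → ℂ := fun p => if ‖l₀ p‖ < R then m₀ p else w p
  have hlnear : ∀ p, ‖l₀ p‖ < R → l p = m₀ p := fun p hp => if_pos hp
  have hlfar : ∀ p, ¬ ‖l₀ p‖ < R → l p = w p := fun p hp => if_neg hp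
  have hm₀R : ∀ p, ‖l₀ p‖ < R → ‖m₀ p‖ < R := fun p hp => by
    simpa using hm₀ p (by simpa using hp)
  refine ⟨l, ⟨hF, fun z => ?_⟩, ?_⟩
  · by_cases hz : ‖z‖ < R
    · rw [hm₀' z (by simpa using hz)]
      congr 1
      ext p
      simp only [mem_ofPred_eq, Finite.mem_toFinset]
      by_cases hp : ‖l₀ p‖ < R
      · simp [hlnear p hp, hp]
      · rw [hlfar p hp]
        simp only [hp, false_and, iff_false]
        rintro rfl
        exact absurd hz (hwR p hp).not_gt
    · by_cases hzp : ∃ p, ‖z - l₀ p‖ < δ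
      · obtain ⟨p, hzp⟩ := hzp
        have hp : ¬ ‖l₀ p‖ < R := fun hp => absurd hzp (hdist z p (not_lt.1 hz) hp).not_gt
        rw [hw' p hp z (mem_ball_iff_norm.2 hzp)]
        have hset : ∀ q, l q = z → q = p := by
          rintro q rfl
          by_contra hqp
          by_cases hq : ‖l₀ q‖ < R
          · rw [hlnear q hq] at hz; exact hz (hm₀R q hq)
          · rw [hlfar q hq] at hzp
            have h1 := hsep p q (Ne.symm hqp) (by linarith [hfar p hp])
            have h2 := mem_ball_iff_norm.1 (hw q hq)
            have h3 := norm_sub_le_norm_sub_add_norm_sub (l₀ p) (w q) (l₀ q)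
            rw [norm_sub_rev (l₀ p) (w q)] at h3
            linarith
        split_ifs with h
        · have : {q | l q = z} = {p} := by
            ext q
            simp only [mem_ofPred_eq, mem_singleton_iff]
            exact ⟨hset q, fun h' => by rw [h', hlfar p hp, h]⟩
          rw [this, encard_singleton]
        · have : {q | l q = z} = ∅ := by
            ext q
            simp only [mem_ofPred_eq, mem_empty_iff_false, iff_false]
            intro hq
            have := hset q hq
            subst this
            rw [hlfar q hp] at hq
            exact h hq
          rw [this, encard_empty]
      · push Not at hzp
        have h1 := hT₁ z (by linarith) hzp
        have h2 : F z ≠ 0 := fun h0 => by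
          rw [h0, zero_sub, norm_neg] at h1; exact lt_irrefl _ h1
        rw [(hF.analyticAt z).analyticOrderAt_eq_zero.2 h2]
        have : {q | l q = z} = ∅ := by
          ext q
          simp only [mem_ofPred_eq, mem_empty_iff_false, iff_false]
          rintro rfl
          by_cases hq : ‖l₀ q‖ < R
          · rw [hlnear q hq] at hz; exact hz (hm₀R q hq)
          · have h3 := hzp q
            rw [hlfar q hq] at h3
            exact absurd (mem_ball_iff_norm.1 (hw q hq)) h3.not_gt
        rw [this, encard_empty]
  · rw [Metric.tendsto_nhds]
    intro ε' hε'
    -- Rouché on the smaller circle gives a zero near `l₀ p`; uniqueness in the disc of radius `δ`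
    -- identifies it with `w p`.
    obtain ⟨T, hT⟩ := hdom (min ε' δ) (lt_min hε' hδ)
    filter_upwards [htend.eventually (eventually_ge_atTop (max R (T + δ)))] with p hp
    have hpR : ¬ ‖l₀ p‖ < R := not_lt.2 ((le_max_left _ _).trans hp)
    have hpT : T + δ ≤ ‖l₀ p‖ := (le_max_right _ _).trans hp
    obtain ⟨x, hx, hx'⟩ := hsmall p hpR _ (lt_min hε' hδ) (min_le_right _ _) (fun z hz =>
      hT z (by
        have h1 := norm_sub_norm_le (l₀ p) z
        rw [norm_sub_rev, mem_sphere_iff_norm.1 hz] at h1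
        linarith [min_le_right ε' δ]) (hother p hpR _ (lt_min hε' hδ) (min_le_right _ _) z hz))
    have h1 := hx' x hx
    rw [if_pos rfl, hw' p hpR x (Metric.ball_subset_ball (min_le_right _ _) hx)] at h1
    have h2 : w p = x := by
      by_contra h
      rw [if_neg h] at h1
      exact zero_ne_one h1
    rw [dist_zero_right, hlfar p hpR, h2]
    exact (mem_ball_iff_norm.1 hx).trans_le (min_le_left _ _)

/-! ### Linear differential equations through Volterra operators -/

/-- `1 - K` is a commuting factor of the unit `1 - K ^ n`. This suits Volterra operators, whose norm
may exceed 1 while their powers decay factorially. -/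
theorem isUnit_one_sub_of_norm_pow_lt_one {R : Type*} [NormedRing R] [CompleteSpace R] {K : R}
    {n : ℕ} (h : ‖K ^ n‖ < 1) : IsUnit (1 - K) := by
  have h2 : IsUnit (1 - K ^ n) := isUnit_one_sub_of_norm_lt_one h
  rw [← mul_neg_geom_sum] at h2
  have : Commute (1 - K) (∑ i ∈ Finset.range n, K ^ i) :=
    Commute.sum_right _ _ _ fun i _ => ((Commute.one_left K).sub_left (Commute.refl K)).pow_right i
  exact (this.isUnit_mul_iff.1 h2).1

theorem differentiableAt_inverse_one_sub_add_smul {R : Type*} [NormedRing R] [NormedAlgebra ℂ R]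
    [CompleteSpace R] (K L : R) {z : ℂ} (h : IsUnit (1 - (K + z • L))) :
    DifferentiableAt ℂ (fun z : ℂ => Ring.inverse (1 - (K + z • L))) z :=
  DifferentiableAt.inverse
    (((differentiableAt_id.smul_const L).const_add K).const_sub 1) h

section LinearODE

variable {W : Type*} [NormedAddCommGroup W] [NormedSpace ℂ W]

/-- `projIcc` extends functions on `[0,1]` to the line by their end values, so that interval
integrals over the line can be used. -/
theorem continuous_apply_projIcc (A : C(Icc (0 : ℝ) 1, W →L[ℂ] W)) (f : C(Icc (0 : ℝ) 1, W)) :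
    Continuous fun s : ℝ => A (projIcc 0 1 zero_le_one s) (f (projIcc 0 1 zero_le_one s)) :=
  (A.continuous.comp continuous_projIcc).clm_apply (f.continuous.comp continuous_projIcc)

theorem norm_apply_projIcc_le (A : C(Icc (0 : ℝ) 1, W →L[ℂ] W)) (f : C(Icc (0 : ℝ) 1, W)) (s : ℝ) :
    ‖A (projIcc 0 1 zero_le_one s) (f (projIcc 0 1 zero_le_one s))‖ ≤
      ‖A‖ * ‖f (projIcc 0 1 zero_le_one s)‖ :=
  ((A _).le_opNorm _).trans (mul_le_mul_of_nonneg_right (A.norm_coe_le_norm _) (norm_nonneg _))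

/-- The Volterra operator `f ↦ ∫₀ˣ A(s) f(s) ds` on `C([0,1], W)`. -/
noncomputable def volterra (A : C(Icc (0 : ℝ) 1, W →L[ℂ] W)) :
    C(Icc (0 : ℝ) 1, W) →L[ℂ] C(Icc (0 : ℝ) 1, W) :=
  LinearMap.mkContinuous
    { toFun := fun f =>
        { toFun := fun x => ∫ s in (0 : ℝ)..x,
            A (projIcc 0 1 zero_le_one s) (f (projIcc 0 1 zero_le_one s))
          continuous_toFun := (intervalIntegral.continuous_primitive
            (fun a b => (continuous_apply_projIcc A f).intervalIntegrable a b) 0).comp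
              continuous_subtype_val }
      map_add' := fun f g => by
        ext x
        simp only [ContinuousMap.coe_mk, ContinuousMap.add_apply, map_add]
        exact intervalIntegral.integral_add ((continuous_apply_projIcc A f).intervalIntegrable _ _)
          ((continuous_apply_projIcc A g).intervalIntegrable _ _)
      map_smul' := fun c f => by
        ext x
        simp only [ContinuousMap.coe_mk, ContinuousMap.smul_apply, map_smul, RingHom.id_apply]
        exact intervalIntegral.integral_smul c _ }
    ‖A‖ fun f => by
      refine (ContinuousMap.norm_le _ (by positivity)).2 fun x => ?_
      have h : ∀ s ∈ Set.uIoc (0 : ℝ) x, ‖A (projIcc 0 1 zero_le_one s)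
          (f (projIcc 0 1 zero_le_one s))‖ ≤ ‖A‖ * ‖f‖ := fun s _ =>
        (norm_apply_projIcc_le A f s).trans (by gcongr; exact f.norm_coe_le_norm _)
      refine (intervalIntegral.norm_integral_le_of_norm_le_const h).trans ?_
      rw [sub_zero, abs_of_nonneg x.2.1]
      exact mul_le_of_le_one_right (by positivity) x.2.2

theorem volterra_apply (A : C(Icc (0 : ℝ) 1, W →L[ℂ] W)) (f : C(Icc (0 : ℝ) 1, W))
    (x : Icc (0 : ℝ) 1) : volterra A f x = ∫ s in (0 : ℝ)..x,
      A (projIcc 0 1 zero_le_one s) (f (projIcc 0 1 zero_le_one s)) := rfl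

theorem volterra_add_smul (A B : C(Icc (0 : ℝ) 1, W →L[ℂ] W)) (c : ℂ) :
    volterra (A + c • B) = volterra A + c • volterra B := by
  ext f x
  simp only [volterra_apply, _root_.add_apply, _root_.smul_apply,
    ContinuousMap.add_apply, ContinuousMap.smul_apply]
  rw [← intervalIntegral.integral_smul]
  exact intervalIntegral.integral_add
    ((continuous_apply_projIcc A f).intervalIntegrable _ _)
    (((continuous_apply_projIcc B f).const_smul c).intervalIntegrable _ _)

theorem norm_volterra_pow_apply_le (A : C(Icc (0 : ℝ) 1, W →L[ℂ] W)) (f : C(Icc (0 : ℝ) 1, W))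
    (n : ℕ) (x : Icc (0 : ℝ) 1) :
    ‖(volterra A ^ n) f x‖ ≤ ‖A‖ ^ n * ((x : ℝ) ^ n / n.factorial) * ‖f‖ := by
  induction n generalizing x with
  | zero => simpa using f.norm_coe_le_norm x
  | succ n ih =>
    rw [pow_succ', mul_apply_eq_comp, volterra_apply]
    have h1 : ∀ s ∈ Ioc (0 : ℝ) x, ‖A (projIcc 0 1 zero_le_one s)
        ((volterra A ^ n) f (projIcc 0 1 zero_le_one s))‖ ≤
        ‖A‖ ^ (n + 1) / n.factorial * ‖f‖ * s ^ n := by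
      intro s hs
      have hs' : s ∈ Icc (0 : ℝ) 1 := ⟨hs.1.le, hs.2.trans x.2.2⟩
      refine (norm_apply_projIcc_le A _ s).trans ?_
      have h2 := ih (projIcc 0 1 zero_le_one s)
      rw [projIcc_of_mem _ hs'] at h2 ⊢
      refine (mul_le_mul_of_nonneg_left h2 (norm_nonneg A)).trans_eq ?_
      ring
    refine (intervalIntegral.norm_integral_le_of_norm_le x.2.1 (MeasureTheory.ae_of_all _ h1)
      ((by fun_prop : Continuous fun s : ℝ => ‖A‖ ^ (n + 1) / n.factorial * ‖f‖ * s ^ n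
        ).intervalIntegrable _ _)).trans_eq ?_
    rw [intervalIntegral.integral_const_mul, integral_pow, Nat.factorial_succ]
    push_cast
    have : (n.factorial : ℝ) ≠ 0 := by positivity
    field_simp
    simp [mul_comm]

variable [CompleteSpace W]

theorem isUnit_one_sub_volterra (A : C(Icc (0 : ℝ) 1, W →L[ℂ] W)) : IsUnit (1 - volterra A) := by
  obtain ⟨n, hn⟩ : ∃ n : ℕ, ‖A‖ ^ n / n.factorial < 1 :=
    ((FloorSemiring.tendsto_pow_div_factorial_atTop ‖A‖).eventually (gt_mem_nhds one_pos)).exists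
  have h1 : ‖volterra A ^ n‖ < 1 := by
    refine (ContinuousLinearMap.opNorm_le_bound _ (by positivity) fun f => ?_).trans_lt hn
    refine (ContinuousMap.norm_le _ (by positivity)).2 fun x => ?_
    refine (norm_volterra_pow_apply_le A f n x).trans ?_
    refine mul_le_mul_of_nonneg_right ?_ (norm_nonneg _)
    rw [mul_div_assoc']
    have : (x : ℝ) ^ n ≤ 1 := pow_le_one₀ x.2.1 x.2.2
    gcongr
    exact mul_le_of_le_one_right (by positivity) this
  exact isUnit_one_sub_of_norm_pow_lt_one
    (R := C(Icc (0 : ℝ) 1, W) →L[ℂ] C(Icc (0 : ℝ) 1, W)) h1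

/-- The solution of `y' = A y`, `y(0) = w`, as an element of `C([0,1], W)`. -/
noncomputable def linearFlow (A : C(Icc (0 : ℝ) 1, W →L[ℂ] W)) (w : W) : C(Icc (0 : ℝ) 1, W) :=
  Ring.inverse (1 - volterra A) (ContinuousMap.const _ w)

theorem linearFlow_eq_iff (A : C(Icc (0 : ℝ) 1, W →L[ℂ] W)) (w : W) (y : C(Icc (0 : ℝ) 1, W)) :
    y = linearFlow A w ↔ ∀ x, y x = w + volterra A y x := by
  have hu := isUnit_one_sub_volterra A
  have key : (∀ x, y x = w + volterra A y x) ↔ (1 - volterra A) y = ContinuousMap.const _ w := by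
    rw [ContinuousMap.ext_iff]
    refine forall_congr' fun x => ?_
    simp [sub_eq_iff_eq_add]
  rw [key]
  constructor
  · rintro rfl
    rw [linearFlow, ← mul_apply_eq_comp, Ring.mul_inverse_cancel _ hu]; rfl
  · intro h
    rw [linearFlow, ← h, ← mul_apply_eq_comp, Ring.inverse_mul_cancel _ hu]; rfl

theorem hasDerivWithinAt_linearFlow (A : C(Icc (0 : ℝ) 1, W →L[ℂ] W)) (w : W) {x : ℝ}
    (hx : x ∈ Icc (0 : ℝ) 1) :
    HasDerivWithinAt (fun t => linearFlow A w (projIcc 0 1 zero_le_one t))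
      (A ⟨x, hx⟩ (linearFlow A w ⟨x, hx⟩)) (Icc 0 1) x := by
  have h := (linearFlow_eq_iff A w _).1 rfl
  have hd := (continuous_apply_projIcc A (linearFlow A w)).integral_hasStrictDerivAt 0 x
  have hd' := (hd.hasDerivAt.const_add w).hasDerivWithinAt (s := Icc 0 1)
  rw [projIcc_of_mem _ hx] at hd'
  refine hd'.congr (fun t ht => ?_) ?_
  · rw [h, projIcc_of_mem _ ht, volterra_apply]
  · rw [h, projIcc_of_mem _ hx, volterra_apply]

theorem linearFlow_zero (A : C(Icc (0 : ℝ) 1, W →L[ℂ] W)) (w : W) :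
    linearFlow A w (projIcc 0 1 zero_le_one 0) = w := by
  rw [(linearFlow_eq_iff A w _).1 rfl, volterra_apply]
  simp

theorem eq_linearFlow_of_hasDerivWithinAt (A : C(Icc (0 : ℝ) 1, W →L[ℂ] W)) {y : ℝ → W}
    (hy : ∀ x (hx : x ∈ Icc (0 : ℝ) 1), HasDerivWithinAt y (A ⟨x, hx⟩ (y x)) (Icc 0 1) x) {x : ℝ}
    (hx : x ∈ Icc (0 : ℝ) 1) : y x = linearFlow A (y 0) ⟨x, hx⟩ := by
  have hc : ContinuousOn y (Icc 0 1) := fun x hx => (hy x hx).continuousWithinAt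
  let Y : C(Icc (0 : ℝ) 1, W) := ⟨fun x => y x, continuousOn_iff_continuous_domRestrict.1 hc⟩
  have hY : Y = linearFlow A (y 0) := by
    rw [linearFlow_eq_iff]
    rintro ⟨t, ht⟩
    rw [volterra_apply, intervalIntegral.integral_eq_sub_of_hasDerivAt_of_le (f := y) ht.1
      (hc.mono (Icc_subset_Icc_right ht.2)) (fun s hs => ?_)
      ((continuous_apply_projIcc A Y).intervalIntegrable _ _)]
    · rw [add_sub_cancel]; rfl
    · have hs' : s ∈ Icc (0 : ℝ) 1 := ⟨hs.1.le, hs.2.le.trans ht.2⟩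
      have := (hy s hs').hasDerivAt (Icc_mem_nhds hs.1 (hs.2.trans_le ht.2))
      rw [projIcc_of_mem _ hs']
      exact this
  exact DFunLike.congr_fun hY ⟨x, hx⟩

/-- The Volterra operator is affine in `z`, and inversion in a Banach algebra is differentiable at
units. This is what makes the characteristic determinant entire. -/
theorem differentiable_linearFlow (A B : C(Icc (0 : ℝ) 1, W →L[ℂ] W)) (w : W)
    (x : Icc (0 : ℝ) 1) : Differentiable ℂ fun z : ℂ => linearFlow (A + z • B) w x := by
  intro z
  have h : DifferentiableAt ℂ (fun z : ℂ => Ring.inverse (1 - volterra (A + z • B))) z := by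
    have hu := isUnit_one_sub_volterra (A + z • B)
    simp only [volterra_add_smul] at hu ⊢
    exact differentiableAt_inverse_one_sub_add_smul
      (R := C(Icc (0 : ℝ) 1, W) →L[ℂ] C(Icc (0 : ℝ) 1, W)) (volterra A) (volterra B) hu
  exact ((ContinuousMap.evalCLM ℂ x).differentiableAt).comp z
    (h.clm_apply (differentiableAt_const _))

end LinearODE

/-! ### Estimates for the two-dimensional system -/

section Estimates

variable {μ : ℂ} {a c p r : ℝ → ℂ} {M : ℝ}

/-- Energy estimate: the term with `μ` has the good sign, and each of the two coupling terms
contributes at most `2 M |p| |r|` to the derivative of `|p|² + |r|²`, so by `2 |p| |r| ≤ |p|² +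
|r|²` the rate is at most `2 M`. The bound does not depend on `μ`. -/
theorem norm_sq_add_norm_sq_le_exp
    (hp : ∀ x ∈ Icc (0 : ℝ) 1, HasDerivWithinAt p (a x * r x) (Icc 0 1) x)
    (hr : ∀ x ∈ Icc (0 : ℝ) 1, HasDerivWithinAt r (μ * r x + c x * p x) (Icc 0 1) x)
    (hμ : μ.re ≤ 0) (ha : ∀ x ∈ Icc (0 : ℝ) 1, ‖a x‖ ≤ M) (hc : ∀ x ∈ Icc (0 : ℝ) 1, ‖c x‖ ≤ M)
    {x : ℝ} (hx : x ∈ Icc (0 : ℝ) 1) :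
    ‖p x‖ ^ 2 + ‖r x‖ ^ 2 ≤ Real.exp (2 * M * x) * (‖p 0‖ ^ 2 + ‖r 0‖ ^ 2) := by
  have hd : ∀ x ∈ Icc (0 : ℝ) 1,
      HasDerivWithinAt (fun x => Real.exp (-(2 * M * x)) * (‖p x‖ ^ 2 + ‖r x‖ ^ 2))
        (Real.exp (-(2 * M * x)) * (-(2 * M * 1)) * (‖p x‖ ^ 2 + ‖r x‖ ^ 2) +
          Real.exp (-(2 * M * x)) * (2 * inner ℝ (p x) (a x * r x) +
            2 * inner ℝ (r x) (μ * r x + c x * p x))) (Icc 0 1) x := fun x hx =>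
    (((hasDerivAt_id x).const_mul (2 * M)).neg.exp.hasDerivWithinAt).mul
      ((hp x hx).norm_sq.add (hr x hx).norm_sq)
  have hanti := antitoneOn_of_hasDerivWithinAt_nonpos (convex_Icc (0 : ℝ) 1)
    (fun x hx => (hd x hx).continuousWithinAt)
    (fun x hx => (hd x (interior_subset hx)).mono interior_subset) (fun x hx => by
      have hx' := interior_subset hx
      have h1 : inner ℝ (p x) (a x * r x) ≤ ‖p x‖ * (M * ‖r x‖) := by
        refine (real_inner_le_norm _ _).trans ?_
        rw [norm_mul]
        gcongr
        exact ha x hx'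
      have h2 : inner ℝ (r x) (c x * p x) ≤ ‖r x‖ * (M * ‖p x‖) := by
        refine (real_inner_le_norm _ _).trans ?_
        rw [norm_mul]
        gcongr
        exact hc x hx'
      have h3 : inner ℝ (r x) (μ * r x) ≤ 0 := by
        rw [Complex.inner]
        have : (μ * r x * (starRingEnd ℂ) (r x)).re = μ.re * Complex.normSq (r x) := by
          rw [mul_assoc, Complex.mul_conj, Complex.re_mul_ofReal]
        rw [this]
        exact mul_nonpos_of_nonpos_of_nonneg hμ (Complex.normSq_nonneg _)
      have hM : 0 ≤ M := (norm_nonneg _).trans (ha x hx')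
      rw [inner_add_right]
      have h4 : 0 ≤ Real.exp (-(2 * M * x)) := (Real.exp_pos _).le
      have h5 := mul_nonneg hM (sq_nonneg (‖p x‖ - ‖r x‖))
      have h6 : -(2 * M) * (‖p x‖ ^ 2 + ‖r x‖ ^ 2) + (2 * inner ℝ (p x) (a x * r x) +
          2 * (inner ℝ (r x) (μ * r x) + inner ℝ (r x) (c x * p x))) ≤ 0 := by nlinarith
      have := mul_nonpos_of_nonneg_of_nonpos h4 h6
      linarith)
  have h := hanti (left_mem_Icc.2 zero_le_one) hx hx.1
  simp only [mul_zero, neg_zero, Real.exp_zero, one_mul] at h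
  rw [Real.exp_neg, inv_mul_le_iff₀ (Real.exp_pos _)] at h
  exact h

theorem norm_le_exp_of_initial
    (hp : ∀ x ∈ Icc (0 : ℝ) 1, HasDerivWithinAt p (a x * r x) (Icc 0 1) x)
    (hr : ∀ x ∈ Icc (0 : ℝ) 1, HasDerivWithinAt r (μ * r x + c x * p x) (Icc 0 1) x)
    (hμ : μ.re ≤ 0) (ha : ∀ x ∈ Icc (0 : ℝ) 1, ‖a x‖ ≤ M) (hc : ∀ x ∈ Icc (0 : ℝ) 1, ‖c x‖ ≤ M)
    (h0 : ‖p 0‖ ^ 2 + ‖r 0‖ ^ 2 = 1) {x : ℝ} (hx : x ∈ Icc (0 : ℝ) 1) :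
    ‖p x‖ ≤ Real.exp M ∧ ‖r x‖ ≤ Real.exp M := by
  have hM : 0 ≤ M := (norm_nonneg _).trans (ha x hx)
  have h1 := norm_sq_add_norm_sq_le_exp hp hr hμ ha hc hx
  have h2 : Real.exp (2 * M * x) ≤ Real.exp M ^ 2 := by
    rw [← Real.exp_nat_mul]
    refine Real.exp_le_exp.2 ?_
    push_cast
    exact mul_le_of_le_one_right (by positivity) hx.2
  rw [h0, mul_one] at h1
  constructor
  · exact le_of_sq_le_sq (by nlinarith [sq_nonneg ‖r x‖]) (Real.exp_pos _).le
  · exact le_of_sq_le_sq (by nlinarith [sq_nonneg ‖p x‖]) (Real.exp_pos _).le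

theorem hasDerivAt_exp_mul_sub (μ : ℂ) (x s : ℝ) :
    HasDerivAt (fun s : ℝ => Complex.exp (μ * (x - s))) (-μ * Complex.exp (μ * (x - s))) s := by
  have h := (((Complex.ofRealCLM.hasDerivAt (x := s)).const_sub (x : ℂ)).const_mul μ).cexp
  refine h.congr_deriv ?_
  simp [mul_comm]

theorem norm_exp_mul_sub_le {μ : ℂ} (hμ : μ.re ≤ 0) {x s : ℝ} (hs : s ≤ x) :
    ‖Complex.exp (μ * (x - s))‖ ≤ 1 := by
  rw [Complex.norm_exp, ← Complex.ofReal_sub, Complex.re_mul_ofReal]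
  exact Real.exp_le_one_iff.2 (mul_nonpos_of_nonpos_of_nonneg hμ (by linarith))

/-- Duhamel's formula as an estimate. -/
theorem norm_sub_exp_mul_le {μ : ℂ} (hμ : μ.re ≤ 0) {k g : ℝ → ℂ} {C : ℝ}
    (hk : ∀ x ∈ Icc (0 : ℝ) 1, HasDerivWithinAt k (μ * k x + g x) (Icc 0 1) x)
    (hg : ∀ x ∈ Icc (0 : ℝ) 1, ‖g x‖ ≤ C) {x : ℝ} (hx : x ∈ Icc (0 : ℝ) 1) :
    ‖k x - Complex.exp (μ * x) * k 0‖ ≤ C := by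
  have hsub : Icc 0 x ⊆ Icc (0 : ℝ) 1 := Icc_subset_Icc_right hx.2
  have hd : ∀ s ∈ Icc 0 x, HasDerivWithinAt (fun s : ℝ => Complex.exp (μ * (x - s)) * k s)
      (Complex.exp (μ * (x - s)) * g s) (Icc 0 x) s := fun s hs => by
    refine ((hasDerivAt_exp_mul_sub μ x s).hasDerivWithinAt.mul
      ((hk s (hsub hs)).mono hsub)).congr_deriv ?_
    ring
  have hC : 0 ≤ C := (norm_nonneg _).trans (hg x hx)
  have h := (convex_Icc (0 : ℝ) x).norm_image_sub_le_of_norm_hasDerivWithin_le hd (C := C)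
    (fun s hs => by
      rw [norm_mul]
      exact (mul_le_of_le_one_left (norm_nonneg _) (norm_exp_mul_sub_le hμ hs.2)).trans
        (hg s (hsub hs))) (left_mem_Icc.2 hx.1) (right_mem_Icc.2 hx.1)
  simp only [sub_self, mul_zero, Complex.exp_zero, one_mul, Complex.ofReal_zero, sub_zero] at h
  refine h.trans (mul_le_of_le_one_right hC ?_)
  rw [Real.norm_of_nonneg hx.1]
  exact hx.2

/-- The oscillatory version of Duhamel's estimate. -/
theorem norm_sub_exp_mul_le_div {μ : ℂ} (hμ : μ.re ≤ 0) (hμ0 : μ ≠ 0) {k g g' : ℝ → ℂ} {C C' : ℝ}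
    (hk : ∀ x ∈ Icc (0 : ℝ) 1, HasDerivWithinAt k (μ * k x + g x) (Icc 0 1) x)
    (hg' : ∀ x ∈ Icc (0 : ℝ) 1, HasDerivWithinAt g (g' x) (Icc 0 1) x)
    (hgC : ∀ x ∈ Icc (0 : ℝ) 1, ‖g x‖ ≤ C) (hgC' : ∀ x ∈ Icc (0 : ℝ) 1, ‖g' x‖ ≤ C')
    {x : ℝ} (hx : x ∈ Icc (0 : ℝ) 1) :
    ‖k x - Complex.exp (μ * x) * k 0‖ ≤ (2 * C + C') / ‖μ‖ := by
  -- Integration by parts in disguise: `k + g / μ` solves the same equation with the smaller source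
  -- `g' / μ`.
  have h := norm_sub_exp_mul_le hμ (k := fun x => k x + g x / μ) (g := fun x => g' x / μ)
    (C := C' / ‖μ‖) (fun x hx => by
      refine ((hk x hx).add ((hg' x hx).div_const μ)).congr_deriv ?_
      field_simp) (fun x hx => by
      rw [norm_div]; exact div_le_div_of_nonneg_right (hgC' x hx) (norm_nonneg _)) hx
  have h0 : (0 : ℝ) ∈ Icc (0 : ℝ) 1 := left_mem_Icc.2 zero_le_one
  have e : k x - Complex.exp (μ * x) * k 0 = (k x + g x / μ - Complex.exp (μ * x) * (k 0 + g 0 / μ))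
      - g x / μ + Complex.exp (μ * x) * (g 0 / μ) := by ring
  rw [e]
  refine (norm_add_le _ _).trans ((add_le_add_left (norm_sub_le _ _) _).trans ?_)
  have h1 : ‖g x / μ‖ ≤ C / ‖μ‖ := by
    rw [norm_div]; exact div_le_div_of_nonneg_right (hgC x hx) (norm_nonneg _)
  have h2 : ‖Complex.exp (μ * x) * (g 0 / μ)‖ ≤ C / ‖μ‖ := by
    rw [norm_mul, norm_div]
    have := norm_exp_mul_sub_le hμ hx.1
    rw [Complex.ofReal_zero, sub_zero] at this
    exact (mul_le_of_le_one_left (by positivity) this).trans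
      (div_le_div_of_nonneg_right (hgC 0 h0) (norm_nonneg _))
  have e2 : (2 * C + C') / ‖μ‖ = C' / ‖μ‖ + C / ‖μ‖ + C / ‖μ‖ := by ring
  linarith

/-- Duhamel's estimate with source `c p`. The first choice of `ρ` needs no derivative of `c` and
serves small potentials; the second gains `1 / |μ|` and serves large `λ`. -/
theorem norm_sub_exp_mul_le_of_system {c' : ℝ → ℂ} {M' ρ : ℝ}
    (hp : ∀ x ∈ Icc (0 : ℝ) 1, HasDerivWithinAt p (a x * r x) (Icc 0 1) x)
    (hr : ∀ x ∈ Icc (0 : ℝ) 1, HasDerivWithinAt r (μ * r x + c x * p x) (Icc 0 1) x)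
    (hμ : μ.re ≤ 0) (ha : ∀ x ∈ Icc (0 : ℝ) 1, ‖a x‖ ≤ M) (hc : ∀ x ∈ Icc (0 : ℝ) 1, ‖c x‖ ≤ M)
    (hc' : ∀ x ∈ Icc (0 : ℝ) 1, HasDerivWithinAt c (c' x) (Icc 0 1) x)
    (hcM' : ∀ x ∈ Icc (0 : ℝ) 1, ‖c' x‖ ≤ M')
    (h0 : ‖p 0‖ ^ 2 + ‖r 0‖ ^ 2 = 1)
    (hρ : M * Real.exp M ≤ ρ ∨
      μ ≠ 0 ∧ (2 * M + M' + M ^ 2) * Real.exp M / ‖μ‖ ≤ ρ)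
    {x : ℝ} (hx : x ∈ Icc (0 : ℝ) 1) : ‖r x - Complex.exp (μ * x) * r 0‖ ≤ ρ := by
  have hK := fun x hx => norm_le_exp_of_initial hp hr hμ ha hc h0 (x := x) hx
  have hg : ∀ x ∈ Icc (0 : ℝ) 1, ‖c x * p x‖ ≤ M * Real.exp M := fun x hx => by
    rw [norm_mul]
    exact mul_le_mul (hc x hx) (hK x hx).1 (norm_nonneg _) ((norm_nonneg _).trans (hc x hx))
  rcases hρ with hρ | ⟨hμ0, hρ⟩
  · exact (norm_sub_exp_mul_le hμ hr hg hx).trans hρ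
  · refine (norm_sub_exp_mul_le_div hμ hμ0 hr (fun x hx => (hc' x hx).mul (hp x hx)) hg
      (C' := (M' + M ^ 2) * Real.exp M) (fun x hx => ?_) hx).trans (le_trans ?_ hρ)
    · refine (norm_add_le _ _).trans ?_
      have h1 : ‖c' x * p x‖ ≤ M' * Real.exp M := by
        rw [norm_mul]
        exact mul_le_mul (hcM' x hx) (hK x hx).1 (norm_nonneg _)
          ((norm_nonneg _).trans (hcM' x hx))
      have h2 : ‖c x * (a x * r x)‖ ≤ M * (M * Real.exp M) := by
        have hM : 0 ≤ M := (norm_nonneg _).trans (ha x hx)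
        rw [norm_mul, norm_mul]
        exact mul_le_mul (hc x hx) (mul_le_mul (ha x hx) (hK x hx).2 (norm_nonneg _) hM)
          (by positivity) hM
      linarith
    · refine le_of_eq ?_
      ring

/-- Diagonal entries of the monodromy matrix of `y₁' = u y₁ + a y₂`, `y₂' = v y₂ + c y₁` in the
half-plane where the first exponential dominates. Here `(y₁, y₂)` and `(z₁, z₂)` are the two
columns of the fundamental matrix. -/
theorem norm_diagonal_sub_exp_le {u v : ℂ} (huv : v.re ≤ u.re) {y₁ y₂ z₁ z₂ c' : ℝ → ℂ} {M' ρ : ℝ}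
    (hy₁ : ∀ x ∈ Icc (0 : ℝ) 1, HasDerivWithinAt y₁ (u * y₁ x + a x * y₂ x) (Icc 0 1) x)
    (hy₂ : ∀ x ∈ Icc (0 : ℝ) 1, HasDerivWithinAt y₂ (v * y₂ x + c x * y₁ x) (Icc 0 1) x)
    (hz₁ : ∀ x ∈ Icc (0 : ℝ) 1, HasDerivWithinAt z₁ (u * z₁ x + a x * z₂ x) (Icc 0 1) x)
    (hz₂ : ∀ x ∈ Icc (0 : ℝ) 1, HasDerivWithinAt z₂ (v * z₂ x + c x * z₁ x) (Icc 0 1) x)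
    (hy₁0 : y₁ 0 = 1) (hy₂0 : y₂ 0 = 0) (hz₁0 : z₁ 0 = 0) (hz₂0 : z₂ 0 = 1)
    (ha : ∀ x ∈ Icc (0 : ℝ) 1, ‖a x‖ ≤ M) (hc : ∀ x ∈ Icc (0 : ℝ) 1, ‖c x‖ ≤ M)
    (hc' : ∀ x ∈ Icc (0 : ℝ) 1, HasDerivWithinAt c (c' x) (Icc 0 1) x)
    (hcM' : ∀ x ∈ Icc (0 : ℝ) 1, ‖c' x‖ ≤ M')
    (hρ : M * Real.exp M ≤ ρ ∨
      v - u ≠ 0 ∧ (2 * M + M' + M ^ 2) * Real.exp M / ‖v - u‖ ≤ ρ) :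
    ‖y₁ 1 - Complex.exp u‖ ≤ (M + 1) * ρ * Real.exp u.re ∧
      ‖z₂ 1 - Complex.exp v‖ ≤ (M + 1) * ρ * Real.exp u.re := by
  have hμ : (v - u).re ≤ 0 := by simpa using huv
  have h1m : (1 : ℝ) ∈ Icc (0 : ℝ) 1 := right_mem_Icc.2 zero_le_one
  -- Dividing by `e^{u x}` removes the dominant exponential and leaves `μ = v - u`, whose real part
  -- is nonpositive.
  have he : ∀ x : ℝ, HasDerivAt (fun x : ℝ => Complex.exp (-u * x))
      (-u * Complex.exp (-u * x)) x := fun x => by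
    refine (((Complex.ofRealCLM.hasDerivAt (x := x)).const_mul (-u)).cexp).congr_deriv ?_
    simp [mul_comm]
  have hfst : ∀ w₁ w₂ : ℝ → ℂ,
      (∀ x ∈ Icc (0 : ℝ) 1, HasDerivWithinAt w₁ (u * w₁ x + a x * w₂ x) (Icc 0 1) x) →
      ∀ x ∈ Icc (0 : ℝ) 1, HasDerivWithinAt (fun x : ℝ => Complex.exp (-u * x) * w₁ x)
        (a x * (Complex.exp (-u * x) * w₂ x)) (Icc 0 1) x := fun w₁ w₂ h x hx =>
    ((he x).hasDerivWithinAt.mul (h x hx)).congr_deriv (by ring)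
  have hsnd : ∀ w₁ w₂ : ℝ → ℂ,
      (∀ x ∈ Icc (0 : ℝ) 1, HasDerivWithinAt w₂ (v * w₂ x + c x * w₁ x) (Icc 0 1) x) →
      ∀ x ∈ Icc (0 : ℝ) 1, HasDerivWithinAt (fun x : ℝ => Complex.exp (-u * x) * w₂ x)
        ((v - u) * (Complex.exp (-u * x) * w₂ x) + c x * (Complex.exp (-u * x) * w₁ x))
        (Icc 0 1) x := fun w₁ w₂ h x hx =>
    ((he x).hasDerivWithinAt.mul (h x hx)).congr_deriv (by ring)
  have hM : 0 ≤ M := (norm_nonneg _).trans (ha 1 h1m)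
  have hscale : ∀ (w e : ℂ) (B : ℝ), ‖Complex.exp (-u * (1 : ℝ)) * w - e‖ ≤ B →
      ‖w - Complex.exp u * e‖ ≤ B * Real.exp u.re := fun w e B h => by
    have : w - Complex.exp u * e = Complex.exp u * (Complex.exp (-u * (1 : ℝ)) * w - e) := by
      rw [mul_sub, ← mul_assoc, ← Complex.exp_add]; simp
    rw [this, norm_mul, Complex.norm_exp, mul_comm]
    exact mul_le_mul_of_nonneg_right h (Real.exp_pos _).le
  have hY : ∀ x ∈ Icc (0 : ℝ) 1, ‖Complex.exp (-u * x) * y₂ x‖ ≤ ρ := fun x hx => by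
    have := norm_sub_exp_mul_le_of_system (hfst y₁ y₂ hy₁) (hsnd y₁ y₂ hy₂) hμ ha hc hc' hcM'
      (by simp [hy₁0, hy₂0]) hρ hx
    simpa [hy₂0] using this
  have hρ0 : 0 ≤ ρ := (norm_nonneg _).trans (hY 1 h1m)
  have hZ := norm_sub_exp_mul_le_of_system (hfst z₁ z₂ hz₁) (hsnd z₁ z₂ hz₂) hμ ha hc hc' hcM'
      (by simp [hz₁0, hz₂0]) hρ h1m
  constructor
  -- The second component of the first column starts at 0, so it is at most `ρ`; integrating `p' = a
  -- r` makes the first component deviate from 1 by at most `M ρ`.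
  · have h := (convex_Icc (0 : ℝ) 1).norm_image_sub_le_of_norm_hasDerivWithin_le
      (hfst y₁ y₂ hy₁) (C := M * ρ) (fun x hx => by
        rw [norm_mul]; exact mul_le_mul (ha x hx) (hY x hx) (norm_nonneg _) hM)
      (left_mem_Icc.2 zero_le_one) h1m
    have h2 := hscale (y₁ 1) 1 (M * ρ) (by simpa [hy₁0] using h)
    rw [mul_one] at h2
    refine h2.trans (mul_le_mul_of_nonneg_right ?_ (Real.exp_pos _).le)
    linarith
  · have h2 := hscale (z₂ 1) (Complex.exp (v - u)) ρ (by simpa [hz₂0] using hZ)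
    rw [← Complex.exp_add, add_sub_cancel] at h2
    refine h2.trans (mul_le_mul_of_nonneg_right ?_ (Real.exp_pos _).le)
    nlinarith

end Estimates

/-! ### The fundamental matrix: existence and dependence on the spectral parameter -/

/-- The proof uses analyticity only through this: a bounded derivative, for the integration by
parts, and the continuity that comes with it. -/
theorem HasAnalyticContinuation.exists_hasDerivWithinAt {q : ℝ → ℂ}
    (hq : HasAnalyticContinuation q) :
    ∃ (q' : ℝ → ℂ) (M : ℝ), (∀ x ∈ Icc (0 : ℝ) 1, HasDerivWithinAt q (q' x) (Icc 0 1) x) ∧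
      ∀ x ∈ Icc (0 : ℝ) 1, ‖q' x‖ ≤ M := by
  obtain ⟨R, hR, f, hf, hfq⟩ := hq
  have hmem : ∀ x ∈ Icc (0 : ℝ) 1, (x : ℂ) ∈ Metric.ball (0 : ℂ) R := fun x hx => by
    rw [mem_ball_zero_iff, Complex.norm_real, Real.norm_of_nonneg hx.1]
    exact hx.2.trans_lt hR
  have hc : ContinuousOn (fun x : ℝ => deriv f x) (Icc 0 1) :=
    (hf.deriv Metric.isOpen_ball).continuousOn.comp Complex.continuous_ofReal.continuousOn hmem
  obtain ⟨M, hM⟩ := isCompact_Icc.exists_bound_of_continuousOn hc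
  refine ⟨fun x => deriv f x, M, fun x hx => ?_, hM⟩
  have h1 : HasDerivAt f (deriv f x) (x : ℂ) :=
    (hf.differentiableAt (Metric.isOpen_ball.mem_nhds (hmem x hx))).hasDerivAt
  exact h1.comp_ofReal.hasDerivWithinAt.congr (fun t ht => (hfq t ht).symm) (hfq x hx).symm

theorem inv_diagonal_fin_two {b : Fin 2 → ℂ} (hb : ∀ j, b j ≠ 0) :
    (Matrix.diagonal b)⁻¹ = Matrix.diagonal fun j => (b j)⁻¹ := by
  refine Matrix.inv_eq_right_inv ?_
  rw [Matrix.diagonal_mul_diagonal, ← Matrix.diagonal_one]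
  congr 1
  ext j
  exact mul_inv_cancel₀ (hb j)

/-- Multiplication by `i B` gives `y' = i B (lam - Q) y`, written by columns in the shape that the
estimates take. -/
theorem isFundamentalMatrix_iff {b : Fin 2 → ℂ} (hb : ∀ j, b j ≠ 0) {q₁₂ q₂₁ : ℝ → ℂ} {lam : ℂ}
    {Φ : ℝ → Matrix (Fin 2) (Fin 2) ℂ} : IsFundamentalMatrix b q₁₂ q₂₁ lam Φ ↔
      Φ 0 = 1 ∧ ∀ k, ∀ x ∈ Icc (0 : ℝ) 1,
        HasDerivWithinAt (fun t => Φ t 0 k)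
          (I * b 0 * lam * Φ x 0 k + -I * (b 0 * q₁₂ x) * Φ x 1 k) (Icc 0 1) x ∧
        HasDerivWithinAt (fun t => Φ t 1 k)
          (I * b 1 * lam * Φ x 1 k + -I * (b 1 * q₂₁ x) * Φ x 0 k) (Icc 0 1) x := by
  have hb0 := hb 0
  have hb1 := hb 1
  have key : ∀ x (Φ' : Matrix (Fin 2) (Fin 2) ℂ),
      (-I) • ((Matrix.diagonal b)⁻¹ * Φ') + potential q₁₂ q₂₁ x * Φ x = lam • Φ x ↔
      ∀ k, Φ' 0 k = I * b 0 * lam * Φ x 0 k + -I * (b 0 * q₁₂ x) * Φ x 1 k ∧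
        Φ' 1 k = I * b 1 * lam * Φ x 1 k + -I * (b 1 * q₂₁ x) * Φ x 0 k := by
    intro x Φ'
    have e : ∀ β p l s : ℂ, β ≠ 0 → (-I * (β⁻¹ * p) + s = l ↔ p = I * β * (l - s)) := by
      intro β p l s hβ
      rw [← eq_sub_iff_add_eq]
      constructor
      · intro h
        rw [← h]
        field_simp
        rw [Complex.I_sq]; ring
      · rintro rfl
        field_simp
        rw [Complex.I_sq]; ring
    rw [inv_diagonal_fin_two hb, ← Matrix.ext_iff, Fin.forall_fin_two]
    rw [← forall_and]
    refine forall_congr' fun k => and_congr ?_ ?_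
    · simp only [Matrix.add_apply, Matrix.smul_apply, Matrix.diagonal_mul,
        smul_eq_mul]
      simp only [potential, Matrix.mul_apply, Fin.sum_univ_two, Matrix.of_apply, Matrix.cons_val', Matrix.cons_val_zero, Matrix.cons_val_one,
        zero_mul, zero_add, Matrix.cons_val_fin_one]
      rw [e _ _ _ _ hb0]
      ring_nf
    · simp only [Matrix.add_apply, Matrix.smul_apply, Matrix.diagonal_mul,
        smul_eq_mul]
      simp only [potential, Matrix.mul_apply, Fin.sum_univ_two, Matrix.of_apply, Matrix.cons_val', Matrix.cons_val_zero, Matrix.cons_val_one,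
        zero_mul, add_zero, Matrix.cons_val_fin_one]
      rw [e _ _ _ _ hb1]
      ring_nf
  unfold IsFundamentalMatrix
  refine and_congr_right fun _ => ⟨fun h k x hx => ?_, fun h x hx => ?_⟩
  · obtain ⟨Φ', hΦ', he⟩ := h x hx
    rw [key] at he
    exact ⟨(he k).1 ▸ hΦ' 0 k, (he k).2 ▸ hΦ' 1 k⟩
  · refine ⟨Matrix.of ![fun k => I * b 0 * lam * Φ x 0 k + -I * (b 0 * q₁₂ x) * Φ x 1 k,
      fun k => I * b 1 * lam * Φ x 1 k + -I * (b 1 * q₂₁ x) * Φ x 0 k], fun j k => ?_, ?_⟩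
    · fin_cases j
      · exact (h k x hx).1
      · exact (h k x hx).2
    · rw [key]
      exact fun k => ⟨rfl, rfl⟩

section Existence

variable (b : Fin 2 → ℂ) {q₁₂ q₂₁ : ℝ → ℂ}

/-- The coefficient of `y' = i B (lam - Q) y` that does not depend on `lam`. -/
noncomputable def systemCoeff (h₁₂ : ContinuousOn q₁₂ (Icc 0 1)) (h₂₁ : ContinuousOn q₂₁ (Icc 0 1)) :
    C(Icc (0 : ℝ) 1, ℂ × ℂ →L[ℂ] ℂ × ℂ) where
  toFun x := q₁₂ x • ((-I * b 0) • ContinuousLinearMap.snd ℂ ℂ ℂ).prod 0 +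
    q₂₁ x • (0 : ℂ × ℂ →L[ℂ] ℂ).prod ((-I * b 1) • ContinuousLinearMap.fst ℂ ℂ ℂ)
  continuous_toFun :=
    ((continuousOn_iff_continuous_domRestrict.1 h₁₂).smul continuous_const).add
      ((continuousOn_iff_continuous_domRestrict.1 h₂₁).smul continuous_const)

/-- The coefficient of `lam` in `y' = i B (lam - Q) y`. -/
noncomputable def spectralCoeff : C(Icc (0 : ℝ) 1, ℂ × ℂ →L[ℂ] ℂ × ℂ) :=
  ContinuousMap.const _ (((I * b 0) • ContinuousLinearMap.fst ℂ ℂ ℂ).prod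
    ((I * b 1) • ContinuousLinearMap.snd ℂ ℂ ℂ))

theorem systemCoeff_add_smul_apply (h₁₂ : ContinuousOn q₁₂ (Icc 0 1))
    (h₂₁ : ContinuousOn q₂₁ (Icc 0 1)) (lam : ℂ) (x : Icc (0 : ℝ) 1) (w : ℂ × ℂ) :
    (systemCoeff b h₁₂ h₂₁ + lam • spectralCoeff b) x w =
      (I * b 0 * lam * w.1 + -I * (b 0 * q₁₂ x) * w.2,
        I * b 1 * lam * w.2 + -I * (b 1 * q₂₁ x) * w.1) := by
  simp only [systemCoeff, spectralCoeff, ContinuousMap.add_apply, ContinuousMap.smul_apply,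
    ContinuousMap.const_apply, _root_.add_apply, _root_.smul_apply, ContinuousLinearMap.prod_apply,
    ContinuousLinearMap.coe_fst', ContinuousLinearMap.coe_snd', Prod.smul_mk, smul_eq_mul]
  ext <;> simp <;> ring

theorem isFundamentalMatrix_fundamentalMatrix {b : Fin 2 → ℂ} (hb : ∀ j, b j ≠ 0)
    (h₁₂ : ContinuousOn q₁₂ (Icc 0 1)) (h₂₁ : ContinuousOn q₂₁ (Icc 0 1)) (lam : ℂ) :
    IsFundamentalMatrix b q₁₂ q₂₁ lam (fundamentalMatrix b q₁₂ q₂₁ lam) := by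
  refine Classical.epsilon_spec (p := IsFundamentalMatrix b q₁₂ q₂₁ lam) ?_
  let A := systemCoeff b h₁₂ h₂₁ + lam • spectralCoeff b
  let e : Fin 2 → ℂ × ℂ := ![(1, 0), (0, 1)]
  let y : Fin 2 → ℝ → ℂ × ℂ := fun k t => linearFlow A (e k) (projIcc 0 1 zero_le_one t)
  refine ⟨fun t => Matrix.of ![fun k => (y k t).1, fun k => (y k t).2], ?_⟩
  rw [isFundamentalMatrix_iff hb]
  constructor
  · ext j k
    have h : ∀ k, y k 0 = e k := fun k => linearFlow_zero A (e k)
    fin_cases j <;> fin_cases k <;> simp [h, e]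
  · intro k x hx
    have h := hasDerivWithinAt_linearFlow A (e k) hx
    rw [systemCoeff_add_smul_apply] at h
    have h' : y k x = linearFlow A (e k) ⟨x, hx⟩ := by
      simp only [y, projIcc_of_mem _ hx]
    rw [← h'] at h
    exact ⟨h.fst, h.snd⟩

/-- `epsilon` chooses separately for each `lam`; uniqueness identifies every choice on `[0,1]` with
the Volterra solution, which depends analytically on `lam`. -/
theorem differentiable_fundamentalMatrix {b : Fin 2 → ℂ} (hb : ∀ j, b j ≠ 0)
    (h₁₂ : ContinuousOn q₁₂ (Icc 0 1)) (h₂₁ : ContinuousOn q₂₁ (Icc 0 1)) (j k : Fin 2) :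
    Differentiable ℂ fun lam => fundamentalMatrix b q₁₂ q₂₁ lam 1 j k := by
  have h1m : (1 : ℝ) ∈ Icc (0 : ℝ) 1 := right_mem_Icc.2 zero_le_one
  have key : ∀ lam, (fundamentalMatrix b q₁₂ q₂₁ lam 1 0 k, fundamentalMatrix b q₁₂ q₂₁ lam 1 1 k)
      = linearFlow (systemCoeff b h₁₂ h₂₁ + lam • spectralCoeff b)
        ((1 : Matrix (Fin 2) (Fin 2) ℂ) 0 k, (1 : Matrix (Fin 2) (Fin 2) ℂ) 1 k) ⟨1, h1m⟩ := by
    intro lam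
    obtain ⟨h0, hd⟩ := (isFundamentalMatrix_iff hb).1
      (isFundamentalMatrix_fundamentalMatrix hb h₁₂ h₂₁ lam)
    have := eq_linearFlow_of_hasDerivWithinAt (systemCoeff b h₁₂ h₂₁ + lam • spectralCoeff b)
      (y := fun t => (fundamentalMatrix b q₁₂ q₂₁ lam t 0 k, fundamentalMatrix b q₁₂ q₂₁ lam t 1 k))
      (fun x hx => by
        rw [systemCoeff_add_smul_apply]
        exact (hd k x hx).1.prodMk (hd k x hx).2) h1m
    simp only [h0] at this
    exact this
  have hdiff := differentiable_linearFlow (systemCoeff b h₁₂ h₂₁) (spectralCoeff b)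
    ((1 : Matrix (Fin 2) (Fin 2) ℂ) 0 k, (1 : Matrix (Fin 2) (Fin 2) ℂ) 1 k) ⟨1, h1m⟩
  simp only [← key] at hdiff
  fin_cases j
  · exact hdiff.fst
  · exact hdiff.snd

end Existence

/-! ### The characteristic determinant and its distance from the unperturbed one -/

theorem quasiPeriodicDet_eq (b d : Fin 2 → ℂ) (q₁₂ q₂₁ : ℝ → ℂ) (lam : ℂ) :
    quasiPeriodicDet b d q₁₂ q₂₁ lam =
      1 - d 0 * fundamentalMatrix b q₁₂ q₂₁ lam 1 0 0 - d 1 * fundamentalMatrix b q₁₂ q₂₁ lam 1 1 1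
        + d 0 * d 1 * (fundamentalMatrix b q₁₂ q₂₁ lam 1).det := by
  simp only [quasiPeriodicDet, characteristicDet, Matrix.det_fin_two, Matrix.add_apply,
    Matrix.neg_mul, Matrix.neg_apply, Matrix.diagonal_mul, Matrix.one_apply_eq, ne_eq, zero_ne_one,
    not_false_eq_true, Matrix.one_apply_ne, one_ne_zero]
  ring

theorem differentiable_quasiPeriodicDet {b : Fin 2 → ℂ} (hb : ∀ j, b j ≠ 0) (d : Fin 2 → ℂ)
    {q₁₂ q₂₁ : ℝ → ℂ} (h₁₂ : ContinuousOn q₁₂ (Icc 0 1)) (h₂₁ : ContinuousOn q₂₁ (Icc 0 1)) :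
    Differentiable ℂ (quasiPeriodicDet b d q₁₂ q₂₁) := by
  have h := differentiable_fundamentalMatrix hb h₁₂ h₂₁
  have : quasiPeriodicDet b d q₁₂ q₂₁ = fun lam => _ :=
    funext fun lam => quasiPeriodicDet_eq b d q₁₂ q₂₁ lam
  rw [this]
  simp only [Matrix.det_fin_two]
  have h00 := h 0 0
  have h01 := h 0 1
  have h10 := h 1 0
  have h11 := h 1 1
  fun_prop

/-- Liouville's formula: `B Q` has zero diagonal, so the potential does not contribute to the trace.
-/
theorem IsFundamentalMatrix.det_eq_exp {b : Fin 2 → ℂ} (hb : ∀ j, b j ≠ 0) {q₁₂ q₂₁ : ℝ → ℂ}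
    {lam : ℂ} {Φ : ℝ → Matrix (Fin 2) (Fin 2) ℂ} (hΦ : IsFundamentalMatrix b q₁₂ q₂₁ lam Φ) :
    (Φ 1).det = Complex.exp (I * b 0 * lam) * Complex.exp (I * b 1 * lam) := by
  obtain ⟨h0, hd⟩ := (isFundamentalMatrix_iff hb).1 hΦ
  set s : ℂ := I * b 0 * lam + I * b 1 * lam with hs
  have h1m : (1 : ℝ) ∈ Icc (0 : ℝ) 1 := right_mem_Icc.2 zero_le_one
  have hdet : ∀ x ∈ Icc (0 : ℝ) 1, HasDerivWithinAt (fun t => (Φ t).det) (s * (Φ x).det + 0)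
      (Icc 0 1) x := fun x hx => by
    simp only [Matrix.det_fin_two]
    refine (((hd 0 x hx).1.mul (hd 1 x hx).2).sub ((hd 1 x hx).1.mul (hd 0 x hx).2)).congr_deriv ?_
    rw [hs]; ring
  have he : ∀ x : ℝ, HasDerivAt (fun x : ℝ => Complex.exp (-s * x))
      (-s * Complex.exp (-s * x)) x := fun x => by
    refine (((Complex.ofRealCLM.hasDerivAt (x := x)).const_mul (-s)).cexp).congr_deriv ?_
    simp [mul_comm]
  have h := (convex_Icc (0 : ℝ) 1).norm_image_sub_le_of_norm_hasDerivWithin_le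
    (f := fun x : ℝ => Complex.exp (-s * x) * (Φ x).det) (f' := fun _ => 0) (C := 0)
    (fun x hx => ((he x).hasDerivWithinAt.mul (hdet x hx)).congr_deriv (by ring))
    (fun x _ => by simp) (left_mem_Icc.2 zero_le_one) h1m
  have h' : Complex.exp (-s * (1 : ℝ)) * (Φ 1).det = 1 := by
    rw [zero_mul] at h
    have := sub_eq_zero.1 (norm_le_zero_iff.1 h)
    simpa [h0] using this
  rw [← Complex.exp_add, ← hs]
  calc (Φ 1).det = Complex.exp s * (Complex.exp (-s * (1 : ℝ)) * (Φ 1).det) := by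
        rw [← mul_assoc, ← Complex.exp_add]; simp
    _ = Complex.exp s := by rw [h', mul_one]

theorem norm_quasiPeriodicDet_sub_le {b : Fin 2 → ℂ} (hb : ∀ j, b j ≠ 0) (d : Fin 2 → ℂ)
    {q₁₂ q₂₁ q₁₂' q₂₁' : ℝ → ℂ} {M M' ρ : ℝ} (lam : ℂ)
    (hM₁₂ : ∀ x ∈ Icc (0 : ℝ) 1, ‖b 0 * q₁₂ x‖ ≤ M) (hM₂₁ : ∀ x ∈ Icc (0 : ℝ) 1, ‖b 1 * q₂₁ x‖ ≤ M)
    (hd₁₂ : ∀ x ∈ Icc (0 : ℝ) 1, HasDerivWithinAt q₁₂ (q₁₂' x) (Icc 0 1) x)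
    (hd₂₁ : ∀ x ∈ Icc (0 : ℝ) 1, HasDerivWithinAt q₂₁ (q₂₁' x) (Icc 0 1) x)
    (hM'₁₂ : ∀ x ∈ Icc (0 : ℝ) 1, ‖b 0 * q₁₂' x‖ ≤ M')
    (hM'₂₁ : ∀ x ∈ Icc (0 : ℝ) 1, ‖b 1 * q₂₁' x‖ ≤ M')
    (hρ : M * Real.exp M ≤ ρ ∨ (b 0 - b 1) * lam ≠ 0 ∧
      (2 * M + M' + M ^ 2) * Real.exp M / ‖(b 0 - b 1) * lam‖ ≤ ρ) :
    ‖quasiPeriodicDet b d q₁₂ q₂₁ lam -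
        (1 - d 0 * Complex.exp (I * b 0 * lam)) * (1 - d 1 * Complex.exp (I * b 1 * lam))‖ ≤
      (‖d 0‖ + ‖d 1‖) * ((M + 1) * ρ) *
        max (Real.exp (I * b 0 * lam).re) (Real.exp (I * b 1 * lam).re) := by
  have hΦ := isFundamentalMatrix_fundamentalMatrix hb (fun x hx => (hd₁₂ x hx).continuousWithinAt)
    (fun x hx => (hd₂₁ x hx).continuousWithinAt) lam
  set Φ := fundamentalMatrix b q₁₂ q₂₁ lam with hΦdef
  obtain ⟨h0, hd⟩ := (isFundamentalMatrix_iff hb).1 hΦ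
  set u := I * b 0 * lam with hu
  set v := I * b 1 * lam with hv
  have huv : v - u = -I * ((b 0 - b 1) * lam) := by rw [hu, hv]; ring
  have hvu : u - v = I * ((b 0 - b 1) * lam) := by rw [hu, hv]; ring
  have hM0 : 0 ≤ M := (norm_nonneg _).trans (hM₁₂ 0 (left_mem_Icc.2 zero_le_one))
  have hnI : ∀ z : ℂ, ‖-I * z‖ = ‖z‖ := fun z => by simp
  have e00 : Φ 0 0 0 = 1 := by rw [h0]; simp
  have e01 : Φ 0 0 1 = 0 := by rw [h0]; simp
  have e10 : Φ 0 1 0 = 0 := by rw [h0]; simp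
  have e11 : Φ 0 1 1 = 1 := by rw [h0]; simp
  have main : ‖Φ 1 0 0 - Complex.exp u‖ ≤ (M + 1) * ρ * max (Real.exp u.re) (Real.exp v.re) ∧
      ‖Φ 1 1 1 - Complex.exp v‖ ≤ (M + 1) * ρ * max (Real.exp u.re) (Real.exp v.re) := by
    -- In the other half-plane the two components, and the two columns, exchange roles.
    rcases le_total v.re u.re with hle | hle
    · rw [max_eq_left (Real.exp_le_exp.2 hle)]
      exact norm_diagonal_sub_exp_le (a := fun x => -I * (b 0 * q₁₂ x))
        (c := fun x => -I * (b 1 * q₂₁ x)) (c' := fun x => -I * (b 1 * q₂₁' x)) hle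
        (fun x hx => (hd 0 x hx).1) (fun x hx => (hd 0 x hx).2)
        (fun x hx => (hd 1 x hx).1) (fun x hx => (hd 1 x hx).2) e00 e10 e01 e11
        (fun x hx => (hnI _).trans_le (hM₁₂ x hx)) (fun x hx => (hnI _).trans_le (hM₂₁ x hx))
        (fun x hx => ((hd₂₁ x hx).const_mul _).const_mul _)
        (fun x hx => (hnI _).trans_le (hM'₂₁ x hx))
        (by rw [huv, hnI]; simpa using hρ)
    · rw [max_eq_right (Real.exp_le_exp.2 hle)]
      exact (norm_diagonal_sub_exp_le (a := fun x => -I * (b 1 * q₂₁ x))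
        (c := fun x => -I * (b 0 * q₁₂ x)) (c' := fun x => -I * (b 0 * q₁₂' x)) hle
        (fun x hx => (hd 1 x hx).2) (fun x hx => (hd 1 x hx).1)
        (fun x hx => (hd 0 x hx).2) (fun x hx => (hd 0 x hx).1) e11 e01 e10 e00
        (fun x hx => (hnI _).trans_le (hM₂₁ x hx)) (fun x hx => (hnI _).trans_le (hM₁₂ x hx))
        (fun x hx => ((hd₁₂ x hx).const_mul _).const_mul _)
        (fun x hx => (hnI _).trans_le (hM'₁₂ x hx))
        (by rw [hvu, norm_mul, norm_I, one_mul]; simpa using hρ)).symm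
  have hdiff : quasiPeriodicDet b d q₁₂ q₂₁ lam -
        (1 - d 0 * Complex.exp u) * (1 - d 1 * Complex.exp v) =
      -(d 0 * (Φ 1 0 0 - Complex.exp u)) - d 1 * (Φ 1 1 1 - Complex.exp v) := by
    rw [quasiPeriodicDet_eq, ← hΦdef, hΦ.det_eq_exp hb]
    ring
  rw [hdiff]
  refine (norm_sub_le _ _).trans ?_
  rw [norm_neg, norm_mul, norm_mul]
  have h1 := mul_le_mul_of_nonneg_left main.1 (norm_nonneg (d 0))
  have h2 := mul_le_mul_of_nonneg_left main.2 (norm_nonneg (d 1))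
  linarith

/-! ### The unperturbed determinant: lower bound and separation of zeros -/

theorem exists_le_norm_one_sub_exp {ε : ℝ} (hε : 0 < ε) : ∃ c : ℝ, 0 < c ∧ ∀ w : ℂ,
    (∀ n : ℤ, ε ≤ ‖w - n * (2 * Real.pi * I)‖) → c * max 1 (Real.exp w.re) ≤ ‖1 - Complex.exp w‖ := by
  -- One period rectangle of the strip `|Re w| ≤ 1`, without a disc about 0, the only zero of `1 -
  -- e^w` in it. Compactness gives the bound there; outside the strip one of the terms 1 and `e^w`
  -- dominates.
  let K : Set ℂ := (uIcc (-1) 1 ×ℂ uIcc (-Real.pi) Real.pi) ∩ {w | ε ≤ ‖w‖}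
  have hK : IsCompact K := (isCompact_uIcc.reProdIm isCompact_uIcc).inter_right
    (isClosed_le continuous_const continuous_norm)
  have hpi := Real.pi_pos
  have hmem : ∀ w : ℂ, w ∈ K ↔ (|w.re| ≤ 1 ∧ |w.im| ≤ Real.pi) ∧ ε ≤ ‖w‖ := fun w => by
    simp only [K, mem_inter_iff, Complex.mem_reProdIm, mem_ofPred_eq,
      uIcc_of_le (by norm_num : (-1 : ℝ) ≤ 1), uIcc_of_le (by linarith : -Real.pi ≤ Real.pi), mem_Icc,
      abs_le]
  have hpos : ∀ w ∈ K, 0 < ‖1 - Complex.exp w‖ := by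
    intro w hw
    obtain ⟨⟨_, him⟩, hn⟩ := (hmem w).1 hw
    rw [norm_pos_iff, sub_ne_zero]
    intro h
    obtain ⟨n, hn'⟩ := Complex.exp_eq_one_iff.1 h.symm
    have h1 : w.im = n * (2 * Real.pi) := by rw [hn']; simp
    have h2 : |(n : ℝ)| < 1 := by
      rw [h1, abs_mul, abs_of_pos (by positivity : (0 : ℝ) < 2 * Real.pi)] at him
      by_contra h3
      nlinarith [not_lt.1 h3]
    have h3 : n = 0 := by
      have : |n| < 1 := by exact_mod_cast h2
      exact Int.abs_lt_one_iff.1 this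
    rw [hn', h3] at hn
    simp only [Int.cast_zero, zero_mul, norm_zero] at hn
    linarith
  obtain ⟨m, hm0, hm⟩ : ∃ m : ℝ, 0 < m ∧ ∀ w ∈ K, m ≤ ‖1 - Complex.exp w‖ := by
    rcases K.eq_empty_or_nonempty with he | hne
    · exact ⟨1, one_pos, by simp [he]⟩
    · obtain ⟨w₀, hw₀, hmin⟩ := hK.exists_isMinOn hne
        (by fun_prop : ContinuousOn (fun w => ‖1 - Complex.exp w‖) K)
      exact ⟨_, hpos w₀ hw₀, fun w hw => hmin hw⟩
  have he1 : Real.exp (-1) < 1 := by rw [Real.exp_lt_one_iff]; norm_num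
  have he0 := Real.exp_pos (-1)
  -- In the strip the maximum is at most `e`, hence the factor `e⁻¹` next to `m`; outside it the
  -- smaller term is at most `e⁻¹` times the larger.
  refine ⟨min (m * Real.exp (-1)) (1 - Real.exp (-1)), lt_min (by positivity) (by linarith),
    fun w hw => ?_⟩
  have hexp : ‖Complex.exp w‖ = Real.exp w.re := Complex.norm_exp w
  have hE := Real.exp_pos w.re
  by_cases h1 : |w.re| ≤ 1
  · let n := round (w.im / (2 * Real.pi))
    have hn := abs_sub_round (w.im / (2 * Real.pi))
    have hK' : w - n * (2 * Real.pi * I) ∈ K := by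
      refine (hmem _).2 ⟨⟨by simpa using h1, ?_⟩, hw n⟩
      have : (w - n * (2 * Real.pi * I)).im = (w.im / (2 * Real.pi) - n) * (2 * Real.pi) := by
        simp; field_simp
      rw [this, abs_mul, abs_of_pos (by positivity : (0 : ℝ) < 2 * Real.pi)]
      nlinarith
    have h2 := hm _ hK'
    rw [Complex.exp_periodic.sub_int_mul_eq] at h2
    refine le_trans ?_ h2
    have h3 : max 1 (Real.exp w.re) ≤ Real.exp 1 :=
      max_le (Real.one_le_exp zero_le_one) (Real.exp_le_exp.2 (abs_le.1 h1).2)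
    calc min (m * Real.exp (-1)) (1 - Real.exp (-1)) * max 1 (Real.exp w.re)
        ≤ m * Real.exp (-1) * Real.exp 1 :=
          mul_le_mul (min_le_left _ _) h3 (by positivity) (by positivity)
      _ = m := by rw [mul_assoc, ← Real.exp_add]; simp
  · refine (mul_le_mul_of_nonneg_right (min_le_right _ _) (by positivity)).trans ?_
    rcases lt_abs.1 (not_le.1 h1) with h2 | h2
    · have h3 : 1 ≤ Real.exp w.re := Real.one_le_exp (by linarith)
      have h4 : Real.exp (-1) * Real.exp w.re ≥ 1 := by
        rw [← Real.exp_add]; exact Real.one_le_exp (by linarith)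
      have h5 := norm_sub_norm_le (Complex.exp w) 1
      rw [hexp, norm_one, norm_sub_rev] at h5
      rw [max_eq_right h3]
      linarith
    · have h3 : Real.exp w.re ≤ Real.exp (-1) := Real.exp_le_exp.2 (by linarith)
      have h5 := norm_sub_norm_le 1 (Complex.exp w)
      rw [hexp, norm_one] at h5
      rw [max_eq_left (by linarith)]
      linarith

section Unperturbed

variable {b d γ : Fin 2 → ℂ}

/-- The characteristic determinant of the problem with zero potential. -/
noncomputable def unperturbedDet (b d : Fin 2 → ℂ) (z : ℂ) : ℂ :=
  (1 - d 0 * Complex.exp (I * b 0 * z)) * (1 - d 1 * Complex.exp (I * b 1 * z))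

theorem mul_sub_unperturbedZero (hb : ∀ j, b j ≠ 0) (z : ℂ) (n : ℤ) (j : Fin 2) :
    I * b j * (z - unperturbedZero b γ (n, j)) =
      I * b j * z + -2 * Real.pi * I * γ j - n * (2 * Real.pi * I) := by
  have := hb j
  simp only [unperturbedZero]
  field_simp
  ring

theorem mul_exp_eq_exp (hd : ∀ j, d j = Complex.exp (-2 * Real.pi * I * γ j)) (z : ℂ) (j : Fin 2) :
    d j * Complex.exp (I * b j * z) = Complex.exp (I * b j * z + -2 * Real.pi * I * γ j) := by
  rw [hd, ← Complex.exp_add, add_comm]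

theorem mul_exp_eq_one_iff (hb : ∀ j, b j ≠ 0)
    (hd : ∀ j, d j = Complex.exp (-2 * Real.pi * I * γ j)) (z : ℂ) (j : Fin 2) :
    d j * Complex.exp (I * b j * z) = 1 ↔ ∃ n : ℤ, unperturbedZero b γ (n, j) = z := by
  rw [mul_exp_eq_exp hd, Complex.exp_eq_one_iff]
  refine exists_congr fun n => ?_
  rw [← sub_eq_zero, ← mul_sub_unperturbedZero hb, mul_eq_zero, sub_eq_zero]
  simp [hb j, eq_comm]

theorem norm_sub_unperturbedZero_same (n m : ℤ) (j : Fin 2) :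
    ‖unperturbedZero b γ (n, j) - unperturbedZero b γ (m, j)‖ =
      2 * Real.pi / ‖b j‖ * |(n : ℝ) - m| := by
  have : unperturbedZero b γ (n, j) - unperturbedZero b γ (m, j) =
      ((2 * Real.pi : ℝ) : ℂ) * (b j)⁻¹ * ((n - m : ℝ) : ℂ) := by
    simp only [unperturbedZero]; push_cast; ring
  rw [this, norm_mul, norm_mul, norm_inv, Complex.norm_real, Complex.norm_real, Real.norm_eq_abs,
    Real.norm_eq_abs, abs_of_pos Real.two_pi_pos]
  rfl

theorem unperturbedZero_injective_fst (hb : ∀ j, b j ≠ 0) (j : Fin 2) :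
    Function.Injective fun n : ℤ => unperturbedZero b γ (n, j) := by
  intro n m h
  have h1 := norm_sub_unperturbedZero_same (b := b) (γ := γ) n m j
  rw [sub_eq_zero.2 h, norm_zero] at h1
  have h2 : 2 * Real.pi / ‖b j‖ ≠ 0 :=
    div_ne_zero Real.two_pi_pos.ne' (norm_ne_zero_iff.2 (hb j))
  have h3 := (mul_eq_zero.1 h1.symm).resolve_left h2
  exact_mod_cast sub_eq_zero.1 (abs_eq_zero.1 h3)

theorem analyticOrderAt_one_sub_mul_exp (hb : ∀ j, b j ≠ 0)
    (hd : ∀ j, d j = Complex.exp (-2 * Real.pi * I * γ j)) (z : ℂ) (j : Fin 2) :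
    analyticOrderAt (fun z => 1 - d j * Complex.exp (I * b j * z)) z =
      {n : ℤ | unperturbedZero b γ (n, j) = z}.encard := by
  have hdiff : Differentiable ℂ (fun z => 1 - d j * Complex.exp (I * b j * z)) := by fun_prop
  by_cases h : d j * Complex.exp (I * b j * z) = 1
  · obtain ⟨n, hn⟩ := (mul_exp_eq_one_iff hb hd z j).1 h
    have hset : {n : ℤ | unperturbedZero b γ (n, j) = z} = {n} := by
      ext m
      simp only [mem_ofPred_eq, mem_singleton_iff]
      exact ⟨fun hm => unperturbedZero_injective_fst hb j (hm.trans hn.symm), fun hm => hm ▸ hn⟩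
    rw [hset, encard_singleton]
    refine (hdiff.analyticAt z).analyticOrderAt_eq_one_of_zero_deriv_ne_zero (by simp [h]) ?_
    have : HasDerivAt (fun z => 1 - d j * Complex.exp (I * b j * z))
        (-(d j * Complex.exp (I * b j * z) * (I * b j))) z := by
      have h1 := (((hasDerivAt_id z).const_mul (I * b j)).cexp.const_mul (d j)).const_sub 1
      refine h1.congr_deriv ?_
      simp [mul_assoc]
    rw [this.deriv, h]
    simp [hb j]
  · have hset : {n : ℤ | unperturbedZero b γ (n, j) = z} = ∅ := by
      ext m
      simp only [mem_ofPred_eq, mem_empty_iff_false, iff_false]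
      exact fun hm => h ((mul_exp_eq_one_iff hb hd z j).2 ⟨m, hm⟩)
    rw [hset, encard_empty]
    exact (hdiff.analyticAt z).analyticOrderAt_eq_zero.2 (sub_ne_zero.2 (Ne.symm h))

/-- Each factor has simple zeros only, its derivative there being `-i b_j`. A common zero of the two
factors occurs under both values of `j`, in agreement with its order 2. -/
theorem isZeroSequence_unperturbedDet (hb : ∀ j, b j ≠ 0)
    (hd : ∀ j, d j = Complex.exp (-2 * Real.pi * I * γ j)) :
    IsZeroSequence (unperturbedDet b d) (unperturbedZero b γ) := by
  refine ⟨by unfold unperturbedDet; fun_prop, fun z => ?_⟩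
  have h : unperturbedDet b d = (fun z => 1 - d 0 * Complex.exp (I * b 0 * z)) *
      (fun z => 1 - d 1 * Complex.exp (I * b 1 * z)) := rfl
  have h0 : Differentiable ℂ (fun z => 1 - d 0 * Complex.exp (I * b 0 * z)) := by fun_prop
  have h1 : Differentiable ℂ (fun z => 1 - d 1 * Complex.exp (I * b 1 * z)) := by fun_prop
  rw [h, analyticOrderAt_mul (h0.analyticAt z) (h1.analyticAt z),
    analyticOrderAt_one_sub_mul_exp hb hd, analyticOrderAt_one_sub_mul_exp hb hd]
  have hset : {p | unperturbedZero b γ p = z} =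
      (fun n : ℤ => (n, (0 : Fin 2))) '' {n | unperturbedZero b γ (n, 0) = z} ∪
        (fun n : ℤ => (n, (1 : Fin 2))) '' {n | unperturbedZero b γ (n, 1) = z} := by
    ext ⟨n, j⟩
    fin_cases j <;> simp
  have hdisj : Disjoint
      ((fun n : ℤ => (n, (0 : Fin 2))) '' {n | unperturbedZero b γ (n, 0) = z})
      ((fun n : ℤ => (n, (1 : Fin 2))) '' {n | unperturbedZero b γ (n, 1) = z}) := by
    rw [Set.disjoint_left]
    rintro _ ⟨n, _, rfl⟩ ⟨m, _, h⟩
    simp at h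
  rw [hset, encard_union_eq hdisj, (Prod.mk_left_injective (0 : Fin 2)).encard_image,
    (Prod.mk_left_injective (1 : Fin 2)).encard_image]

theorem exists_le_norm_unperturbedDet (hb : ∀ j, b j ≠ 0)
    (hd : ∀ j, d j = Complex.exp (-2 * Real.pi * I * γ j)) {ε : ℝ} (hε : 0 < ε) :
    ∃ c : ℝ, 0 < c ∧ ∀ z : ℂ, (∀ p, ε ≤ ‖z - unperturbedZero b γ p‖) →
      c * max (Real.exp (I * b 0 * z).re) (Real.exp (I * b 1 * z).re) ≤ ‖unperturbedDet b d z‖ := by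
  have hfac : ∀ j, ∃ c : ℝ, 0 < c ∧ ∀ z : ℂ, (∀ p, ε ≤ ‖z - unperturbedZero b γ p‖) →
      c * max 1 (‖d j‖ * Real.exp (I * b j * z).re) ≤ ‖1 - d j * Complex.exp (I * b j * z)‖ := by
    intro j
    have hbj : 0 < ‖b j‖ := norm_pos_iff.2 (hb j)
    obtain ⟨c, hc, h⟩ := exists_le_norm_one_sub_exp (mul_pos hbj hε)
    refine ⟨c, hc, fun z hz => ?_⟩
    have h1 := h (I * b j * z + -2 * Real.pi * I * γ j) fun n => by
      rw [← mul_sub_unperturbedZero hb, norm_mul, norm_mul, norm_I, one_mul]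
      exact mul_le_mul_of_nonneg_left (hz (n, j)) hbj.le
    rw [← Complex.norm_exp, ← mul_exp_eq_exp hd, norm_mul, Complex.norm_exp] at h1
    exact h1
  obtain ⟨c₀, hc₀, h₀⟩ := hfac 0
  obtain ⟨c₁, hc₁, h₁⟩ := hfac 1
  have hdpos : ∀ j, 0 < ‖d j‖ := fun j => by
    rw [norm_pos_iff, hd]; exact Complex.exp_ne_zero _
  refine ⟨c₀ * c₁ * min ‖d 0‖ ‖d 1‖, by have := lt_min (hdpos 0) (hdpos 1); positivity,
    fun z hz => ?_⟩
  rw [unperturbedDet, norm_mul]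
  refine le_trans ?_ (mul_le_mul (h₀ z hz) (h₁ z hz) (by positivity) (norm_nonneg _))
  set E₀ := Real.exp (I * b 0 * z).re
  set E₁ := Real.exp (I * b 1 * z).re
  have hE₀ : 0 < E₀ := Real.exp_pos _
  have hE₁ : 0 < E₁ := Real.exp_pos _
  -- The larger exponential is taken from its own factor and 1 from the other.
  have key : min ‖d 0‖ ‖d 1‖ * max E₀ E₁ ≤ max 1 (‖d 0‖ * E₀) * max 1 (‖d 1‖ * E₁) := by
    rcases le_total E₀ E₁ with h | h
    · rw [max_eq_right h]
      calc min ‖d 0‖ ‖d 1‖ * E₁ ≤ 1 * (‖d 1‖ * E₁) := by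
            rw [one_mul]; exact mul_le_mul_of_nonneg_right (min_le_right _ _) hE₁.le
        _ ≤ _ := mul_le_mul (le_max_left _ _) (le_max_right _ _) (by positivity) (by positivity)
    · rw [max_eq_left h]
      calc min ‖d 0‖ ‖d 1‖ * E₀ ≤ (‖d 0‖ * E₀) * 1 := by
            rw [mul_one]; exact mul_le_mul_of_nonneg_right (min_le_left _ _) hE₀.le
        _ ≤ _ := mul_le_mul (le_max_right _ _) (le_max_left _ _) (by positivity) (by positivity)
  calc c₀ * c₁ * min ‖d 0‖ ‖d 1‖ * max E₀ E₁ = c₀ * c₁ * (min ‖d 0‖ ‖d 1‖ * max E₀ E₁) := by ring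
    _ ≤ c₀ * c₁ * (max 1 (‖d 0‖ * E₀) * max 1 (‖d 1‖ * E₁)) :=
        mul_le_mul_of_nonneg_left key (by positivity)
    _ = _ := by ring

/-- `b₁⁻¹` and `b₂⁻¹` are linearly independent over the reals: the imaginary part of `x - c y`
controls `y`, and then the norm controls `x`. -/
theorem exists_mul_abs_add_abs_le (hb : ∀ j, b j ≠ 0) (him : (b 0 * (b 1)⁻¹).im ≠ 0) :
    ∃ κ : ℝ, 0 < κ ∧ ∀ x y : ℝ, κ * (|x| + |y|) ≤ ‖(b 0)⁻¹ * x - (b 1)⁻¹ * y‖ := by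
  set c := b 0 * (b 1)⁻¹ with hc
  have hb0 : 0 < ‖b 0‖ := norm_pos_iff.2 (hb 0)
  have hi : 0 < |c.im| := abs_pos.2 him
  refine ⟨((1 + (‖c‖ + 1) / |c.im|) * ‖b 0‖)⁻¹, by positivity, fun x y => ?_⟩
  rw [inv_mul_le_iff₀ (by positivity)]
  have e : (b 0)⁻¹ * x - (b 1)⁻¹ * y = (b 0)⁻¹ * (x - c * y) := by
    have := hb 0
    rw [hc]; field_simp
  rw [e, norm_mul (b 0)⁻¹, norm_inv]
  have h1 : |c.im| * |y| ≤ ‖x - c * y‖ := by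
    have := Complex.abs_im_le_norm (x - c * y)
    simpa [abs_mul] using this
  have h2 : |x| ≤ ‖x - c * y‖ + ‖c‖ * |y| := by
    have := norm_add_le (x - c * y) (c * y)
    simpa using this
  have h3 : |y| ≤ ‖x - c * y‖ / |c.im| := by
    rw [le_div_iff₀ hi]; linarith
  calc |x| + |y| ≤ ‖x - c * y‖ + (‖c‖ + 1) * |y| := by linarith
    _ ≤ ‖x - c * y‖ + (‖c‖ + 1) * (‖x - c * y‖ / |c.im|) := by gcongr
    _ = (1 + (‖c‖ + 1) / |c.im|) * ‖b 0‖ * (‖b 0‖⁻¹ * ‖x - c * y‖) := by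
        generalize ‖(x : ℂ) - c * y‖ = t
        generalize ‖c‖ = s
        field_simp

theorem exists_mul_abs_sub_le_norm_unperturbedZero (hb : ∀ j, b j ≠ 0) :
    ∃ κ C : ℝ, 0 < κ ∧ ∀ p : ℤ × Fin 2, κ * |(p.1 : ℝ)| - C ≤ ‖unperturbedZero b γ p‖ := by
  have hj : ∀ j, ∃ κ C : ℝ, 0 < κ ∧ ∀ n : ℤ, κ * |(n : ℝ)| - C ≤ ‖unperturbedZero b γ (n, j)‖ := by
    intro j
    refine ⟨2 * Real.pi / ‖b j‖, ‖unperturbedZero b γ (0, j)‖,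
      div_pos Real.two_pi_pos (norm_pos_iff.2 (hb j)), fun n => ?_⟩
    have h1 := norm_sub_unperturbedZero_same (b := b) (γ := γ) n 0 j
    rw [Int.cast_zero, sub_zero] at h1
    rw [← h1]
    linarith [norm_sub_le (unperturbedZero b γ (n, j)) (unperturbedZero b γ (0, j))]
  choose κ C hκ h using hj
  refine ⟨min (κ 0) (κ 1), max (C 0) (C 1), lt_min (hκ 0) (hκ 1), ?_⟩
  have h' : ∀ j, min (κ 0) (κ 1) ≤ κ j ∧ C j ≤ max (C 0) (C 1) := by
    intro j; fin_cases j <;> simp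
  rintro ⟨n, j⟩
  have h1 := h j n
  have h2 := mul_le_mul_of_nonneg_right (h' j).1 (abs_nonneg (n : ℝ))
  simp only
  linarith [(h' j).2]

theorem exists_eventually_separated_unperturbedZero (hb : ∀ j, b j ≠ 0)
    (him : (b 0 * (b 1)⁻¹).im ≠ 0) : ∃ (δ : ℝ) (N : ℕ), 0 < δ ∧ ∀ p q : ℤ × Fin 2, p ≠ q →
      (N : ℤ) < |p.1| → δ ≤ ‖unperturbedZero b γ p - unperturbedZero b γ q‖ := by
  obtain ⟨κ, hκ, h⟩ := exists_mul_abs_add_abs_le hb him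
  set D := ‖(b 0)⁻¹ * γ 0 - (b 1)⁻¹ * γ 1‖ with hD
  have hmixed : ∀ n m : ℤ, 2 * Real.pi * (κ * (|(n : ℝ)| + |(m : ℝ)|) - D) ≤
      ‖unperturbedZero b γ (n, 0) - unperturbedZero b γ (m, 1)‖ := by
    intro n m
    have e : unperturbedZero b γ (n, 0) - unperturbedZero b γ (m, 1) = ((2 * Real.pi : ℝ) : ℂ) *
        (((b 0)⁻¹ * (n : ℝ) - (b 1)⁻¹ * (m : ℝ)) + ((b 0)⁻¹ * γ 0 - (b 1)⁻¹ * γ 1)) := by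
      simp only [unperturbedZero]; push_cast; ring
    rw [e, norm_mul, Complex.norm_real, Real.norm_of_nonneg Real.two_pi_pos.le]
    refine mul_le_mul_of_nonneg_left ?_ Real.two_pi_pos.le
    have h1 := h n m
    have h2 := norm_sub_le (((b 0)⁻¹ * (n : ℝ) - (b 1)⁻¹ * (m : ℝ)) +
      ((b 0)⁻¹ * γ 0 - (b 1)⁻¹ * γ 1)) ((b 0)⁻¹ * γ 0 - (b 1)⁻¹ * γ 1)
    rw [add_sub_cancel_right] at h2
    linarith
  obtain ⟨N, hN⟩ := exists_nat_ge ((D + 1) / κ)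
  rw [div_le_iff₀ hκ] at hN
  have hpos : ∀ j, 0 < 2 * Real.pi / ‖b j‖ := fun j =>
    div_pos Real.two_pi_pos (norm_pos_iff.2 (hb j))
  set δ := min (2 * Real.pi) (min (2 * Real.pi / ‖b 0‖) (2 * Real.pi / ‖b 1‖)) with hδ
  have hδj : ∀ j, δ ≤ 2 * Real.pi / ‖b j‖ := by
    intro j; fin_cases j <;> simp [hδ]
  have hfar : ∀ n m : ℤ, (N : ℝ) ≤ |(n : ℝ)| + |(m : ℝ)| →
      δ ≤ ‖unperturbedZero b γ (n, 0) - unperturbedZero b γ (m, 1)‖ := by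
    intro n m hnm
    refine (min_le_left _ _).trans (le_trans ?_ (hmixed n m))
    have := mul_le_mul_of_nonneg_left hnm hκ.le
    have h2 : 1 ≤ κ * (|(n : ℝ)| + |(m : ℝ)|) - D := by linarith
    exact le_mul_of_one_le_right Real.two_pi_pos.le h2
  refine ⟨δ, N, lt_min Real.two_pi_pos (lt_min (hpos 0) (hpos 1)), ?_⟩
  rintro ⟨n, j⟩ ⟨m, k⟩ hpq hn
  have hn' : (N : ℝ) ≤ |(n : ℝ)| := by exact_mod_cast hn.le
  by_cases hjk : j = k
  · subst hjk
    have hnm : n ≠ m := fun h => hpq (by rw [h])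
    rw [norm_sub_unperturbedZero_same]
    refine (hδj j).trans (le_mul_of_one_le_right (hpos j).le ?_)
    have : 1 ≤ |n - m| := Int.one_le_abs (sub_ne_zero.2 hnm)
    exact_mod_cast this
  · have hm := abs_nonneg (m : ℝ)
    fin_cases j <;> fin_cases k
    · exact absurd rfl hjk
    · exact hfar n m (by linarith)
    · rw [norm_sub_rev]
      exact hfar m n (by linarith)
    · exact absurd rfl hjk

theorem finite_abs_fst_le (N : ℕ) : {p : ℤ × Fin 2 | |p.1| ≤ N}.Finite := by
  refine ((finite_Icc (-(N : ℤ)) N).prod (finite_univ (α := Fin 2))).subset fun p hp => ?_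
  exact ⟨abs_le.1 hp, mem_univ _⟩

/-- A coincidence means `γ₁ + n = c (γ₂ + m)` with `c = b₁ / b₂`. Its imaginary part determines `α₂
+ m`, its real part then `α₁ + n`, and the fractional parts are exactly the two excluded values,
attained together. -/
theorem SeparationCondition.unperturbedZero_injective (hb : ∀ j, b j ≠ 0)
    (him : (b 0 * (b 1)⁻¹).im ≠ 0) (hγ : ∀ j, (γ j).re ∈ Ico (0 : ℝ) 1)
    (hS : SeparationCondition b γ) : Function.Injective (unperturbedZero b γ) := by
  have hne : ∀ n m : ℤ, unperturbedZero b γ (n, 0) ≠ unperturbedZero b γ (m, 1) := by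
    intro n m h
    set c := b 0 * (b 1)⁻¹ with hc
    have h1 : γ 0 + n = c * (γ 1 + m) := by
      have hb0 := hb 0
      have h2 : (2 * Real.pi : ℂ) ≠ 0 := by simp [Real.pi_ne_zero]
      simp only [unperturbedZero, mul_assoc (2 * Real.pi : ℂ)] at h
      have h3 := mul_left_cancel₀ h2 h
      rw [inv_mul_eq_iff_eq_mul₀ hb0] at h3
      rw [h3, hc]; ring
    have hre := congrArg Complex.re h1
    have hi := congrArg Complex.im h1
    simp only [Complex.add_re, Complex.add_im, Complex.mul_re, Complex.mul_im, Complex.intCast_re,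
      Complex.intCast_im, add_zero] at hre hi
    have e1 : ((γ 0).im - c.re * (γ 1).im) / c.im = (γ 1).re + m := by
      rw [div_eq_iff him]; linarith
    have e0 : (c.re * (γ 0).im - (c.re ^ 2 + c.im ^ 2) * (γ 1).im) / c.im = (γ 0).re + n := by
      rw [div_eq_iff him, hre]
      rw [hi]; ring
    have hfr : ∀ (j : Fin 2) (k : ℤ), Int.fract ((γ j).re + k) = (γ j).re := fun j k => by
      rw [Int.fract_add_intCast, Int.fract_eq_self.2 (hγ j)]
    simp only [SeparationCondition, ← hc, e1, e0, hfr] at hS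
    simp at hS
  rintro ⟨n, j⟩ ⟨m, k⟩ h
  by_cases hjk : j = k
  · subst hjk
    rw [unperturbedZero_injective_fst hb j h]
  · fin_cases j <;> fin_cases k
    · exact absurd rfl hjk
    · exact absurd h (hne n m)
    · exact absurd h.symm (hne m n)
    · exact absurd rfl hjk

/-- Pairs with a large index are covered by the eventual separation; the remaining pairs are finite
in number and have positive distances by injectivity. -/
theorem exists_separated_unperturbedZero (hb : ∀ j, b j ≠ 0) (him : (b 0 * (b 1)⁻¹).im ≠ 0)
    (hinj : Function.Injective (unperturbedZero b γ)) : ∃ δ : ℝ, 0 < δ ∧ ∀ p q : ℤ × Fin 2, p ≠ q →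
      δ ≤ ‖unperturbedZero b γ p - unperturbedZero b γ q‖ := by
  obtain ⟨δ₁, N, hδ₁, h₁⟩ := exists_eventually_separated_unperturbedZero (γ := γ) hb him
  have hfin := (finite_abs_fst_le N).prod (finite_abs_fst_le N)
  obtain ⟨δ₂, hδ₂, h₂⟩ : ∃ δ₂ : ℝ, 0 < δ₂ ∧ ∀ p q : ℤ × Fin 2, |p.1| ≤ N → |q.1| ≤ N → p ≠ q →
      δ₂ ≤ ‖unperturbedZero b γ p - unperturbedZero b γ q‖ := by
    have hev : ∀ᶠ t in 𝓝[>] (0 : ℝ), ∀ x ∈ {p : ℤ × Fin 2 | |p.1| ≤ N} ×ˢ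
        {p : ℤ × Fin 2 | |p.1| ≤ N}, x.1 ≠ x.2 →
          t ≤ ‖unperturbedZero b γ x.1 - unperturbedZero b γ x.2‖ := by
      rw [eventually_all_finite hfin]
      intro x _
      by_cases hx : x.1 = x.2
      · exact Eventually.of_forall fun t h => absurd hx h
      · have hpos : 0 < ‖unperturbedZero b γ x.1 - unperturbedZero b γ x.2‖ :=
          norm_pos_iff.2 (sub_ne_zero.2 fun h => hx (hinj h))
        filter_upwards [Ioo_mem_nhdsGT hpos] with t ht _
        exact ht.2.le
    obtain ⟨t, ht, ht0⟩ := (hev.and self_mem_nhdsWithin).exists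
    exact ⟨t, ht0, fun p q hp hq hpq => ht (p, q) ⟨hp, hq⟩ hpq⟩
  refine ⟨min δ₁ δ₂, lt_min hδ₁ hδ₂, fun p q hpq => ?_⟩
  by_cases hp : |p.1| ≤ N
  · by_cases hq : |q.1| ≤ N
    · exact (min_le_right _ _).trans (h₂ p q hp hq hpq)
    · rw [norm_sub_rev]
      exact (min_le_left _ _).trans (h₁ q p hpq.symm (not_le.1 hq))
  · exact (min_le_left _ _).trans (h₁ p q hpq (not_le.1 hp))

end Unperturbed

/-! ### Radii of the large circles, and the two assertions -/

theorem tendsto_norm_cofinite_of_mul_abs_sub_le {l : ℤ × Fin 2 → ℂ} {κ C : ℝ} (hκ : 0 < κ)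
    (h : ∀ p : ℤ × Fin 2, κ * |(p.1 : ℝ)| - C ≤ ‖l p‖) :
    Tendsto (fun p => ‖l p‖) cofinite atTop := by
  rw [tendsto_atTop]
  intro B
  rw [eventually_cofinite]
  obtain ⟨N, hN⟩ := exists_nat_ge ((B + C) / κ)
  rw [div_le_iff₀ hκ] at hN
  refine (finite_abs_fst_le N).subset fun p hp => ?_
  have h1 : ‖l p‖ < B := not_le.1 hp
  have h2 : |(p.1 : ℝ)| < N := by
    by_contra h3
    have := mul_le_mul_of_nonneg_left (not_lt.1 h3) hκ.le
    linarith [h p]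
  have : |p.1| < N := by exact_mod_cast h2
  exact this.le

theorem exists_radius_of_mul_abs_sub_le {l : ℤ × Fin 2 → ℂ} {κ C δ : ℝ} (hκ : 0 < κ)
    (h : ∀ p : ℤ × Fin 2, κ * |(p.1 : ℝ)| - C ≤ ‖l p‖) (hδ : 0 < δ) (hδκ : 64 * δ ≤ κ) (T : ℝ) :
    ∃ R, T ≤ R ∧ ∀ p, δ ≤ |‖l p‖ - R| := by
  obtain ⟨M, hM⟩ := exists_nat_ge ((T + δ + C) / κ + 1)
  have hM1 : (T + δ + C) ≤ κ * M := by
    have : (T + δ + C) / κ ≤ M := by linarith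
    rw [div_le_iff₀ hκ] at this; linarith
  by_contra! hcon
  -- Pigeonhole: if all `16 M + 17` radii failed, their spacing `4 δ` would give as many distinct
  -- indices, while moduli of this size leave only `2 (4 M + 3)` indices.
  have hk : ∀ k : Fin (16 * (M + 1) + 1), ∃ p, |‖l p‖ - (T + 4 * δ * (k : ℕ))| < δ := fun k =>
    hcon _ (le_add_of_nonneg_right (by positivity))
  choose P hP using hk
  have hinj : Function.Injective P := by
    intro i j hij
    have hi := hP i
    rw [hij] at hi
    have hj := hP j
    rw [abs_lt] at hi hj
    have h1 : |((i : ℕ) : ℝ) - (j : ℕ)| < 1 := by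
      rw [abs_lt]
      constructor <;> nlinarith
    have h2 : |((i : ℕ) : ℤ) - ((j : ℕ) : ℤ)| < 1 := by exact_mod_cast h1
    have h3 := Int.abs_lt_one_iff.1 h2
    exact Fin.ext (by omega)
  have hmaps : ∀ k, P k ∈ Finset.Icc (-(2 * M + 1 : ℤ)) (2 * M + 1) ×ˢ (Finset.univ : Finset (Fin 2)) := by
    intro k
    rw [Finset.mem_product, Finset.mem_Icc, ← abs_le]
    refine ⟨?_, Finset.mem_univ _⟩
    have h1 := (abs_lt.1 (hP k)).2
    have h2 := h (P k)
    have h3 : ((k : ℕ) : ℝ) ≤ 16 * (M + 1) := by exact_mod_cast Nat.lt_succ_iff.1 k.2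
    have h4 : 4 * δ * (k : ℕ) ≤ κ * (M + 1) := by
      have : 4 * δ * (k : ℕ) ≤ 4 * δ * (16 * (M + 1)) := by gcongr
      have h5 : 64 * δ * (M + 1) ≤ κ * (M + 1) := by gcongr
      linarith
    have h6 : κ * |((P k).1 : ℝ)| ≤ κ * (2 * M + 1) := by linarith
    have h7 := le_of_mul_le_mul_left h6 hκ
    exact_mod_cast h7
  have hcard := Finset.card_le_card_of_injOn P (s := Finset.univ) (fun k _ => hmaps k) hinj.injOn
  rw [Finset.card_product, Finset.card_univ, Fintype.card_fin, Int.card_Icc, Finset.card_univ,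
    Fintype.card_fin] at hcard
  omega

theorem HasAnalyticContinuation.norm_le_supNorm {q : ℝ → ℂ} (hq : HasAnalyticContinuation q) {x : ℝ}
    (hx : x ∈ Icc (0 : ℝ) 1) : ‖q x‖ ≤ supNorm q := by
  obtain ⟨q', _, hq', _⟩ := hq.exists_hasDerivWithinAt
  have hc : ContinuousOn q (Icc 0 1) := fun x hx => (hq' x hx).continuousWithinAt
  exact le_csSup (isCompact_Icc.image_of_continuousOn hc.norm).bddAbove (mem_image_of_mem _ hx)

theorem exists_quasiPeriodicDet_zeros {b d γ : Fin 2 → ℂ} (hb : ∀ j, b j ≠ 0)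
    (him : (b 0 * (b 1)⁻¹).im ≠ 0) (hd : ∀ j, d j = Complex.exp (-2 * Real.pi * I * γ j))
    {q₁₂ q₂₁ : ℝ → ℂ} (h₁₂ : HasAnalyticContinuation q₁₂) (h₂₁ : HasAnalyticContinuation q₂₁) :
    ∃ l : ℤ × Fin 2 → ℂ, IsZeroSequence (quasiPeriodicDet b d q₁₂ q₂₁) l ∧
      Tendsto (fun p => l p - unperturbedZero b γ p) cofinite (𝓝 0) := by
  obtain ⟨q₁₂', M₁₂, hd₁₂, hM₁₂⟩ := h₁₂.exists_hasDerivWithinAt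
  obtain ⟨q₂₁', M₂₁, hd₂₁, hM₂₁⟩ := h₂₁.exists_hasDerivWithinAt
  obtain ⟨κ, C, hκ, hκC⟩ := exists_mul_abs_sub_le_norm_unperturbedZero (γ := γ) hb
  obtain ⟨δ, N, hδ, hsep⟩ := exists_eventually_separated_unperturbedZero (γ := γ) hb him
  -- A zero of modulus at least `T + 1` has index beyond `N`. In the choice of radius below, `δ / 2`
  -- serves the separation and `κ / 64` the pigeonhole argument.
  obtain ⟨T, hT⟩ := ((finite_abs_fst_le N).image fun p => ‖unperturbedZero b γ p‖).bddAbove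
  refine (isZeroSequence_unperturbedDet hb hd).exists_perturbation
    (differentiable_quasiPeriodicDet hb d (fun x hx => (hd₁₂ x hx).continuousWithinAt)
      (fun x hx => (hd₂₁ x hx).continuousWithinAt))
    (tendsto_norm_cofinite_of_mul_abs_sub_le hκ hκC) (δ := min (δ / 2) (κ / 64)) (T₀ := T + 1)
    (by positivity) (fun p q hpq hp => ?_) (fun R => exists_radius_of_mul_abs_sub_le hκ hκC
      (by positivity) (by linarith [min_le_right (δ / 2) (κ / 64)]) R) (fun ε hε => ?_)
  · refine le_trans (by linarith [min_le_left (δ / 2) (κ / 64)]) (hsep p q hpq ?_)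
    by_contra h
    have := hT (mem_image_of_mem _ (show |p.1| ≤ (N : ℤ) from not_lt.1 h))
    linarith
  · obtain ⟨c, hc, hcG⟩ := exists_le_norm_unperturbedDet hb hd hε
    set M := max (‖b 0‖ * supNorm q₁₂) (‖b 1‖ * supNorm q₂₁) with hM
    set M' := max (‖b 0‖ * M₁₂) (‖b 1‖ * M₂₁) with hM'
    have hb01 : 0 < ‖b 0 - b 1‖ := by
      rw [norm_pos_iff, sub_ne_zero]
      intro h
      rw [h, mul_inv_cancel₀ (hb 1)] at him
      simp at him
    set S := (‖d 0‖ + ‖d 1‖) * (M + 1) * ((2 * M + M' + M ^ 2) * Real.exp M) with hS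
    have hlim : Tendsto (fun t : ℝ => S / (‖b 0 - b 1‖ * t)) atTop (𝓝 0) :=
      (tendsto_id.const_mul_atTop hb01).const_div_atTop S
    obtain ⟨T₁, hT₁⟩ := eventually_atTop.1 ((hlim.eventually (gt_mem_nhds hc)).and
      (eventually_gt_atTop 0))
    refine ⟨T₁, fun z hz hzp => ?_⟩
    obtain ⟨hz1, hz0⟩ := hT₁ _ hz
    have h := norm_quasiPeriodicDet_sub_le hb d (M := M) (M' := M') z
      (fun x hx => by
        rw [norm_mul]
        exact (mul_le_mul_of_nonneg_left (h₁₂.norm_le_supNorm hx) (norm_nonneg _)).trans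
          (le_max_left _ _))
      (fun x hx => by
        rw [norm_mul]
        exact (mul_le_mul_of_nonneg_left (h₂₁.norm_le_supNorm hx) (norm_nonneg _)).trans
          (le_max_right _ _)) hd₁₂ hd₂₁
      (fun x hx => by
        rw [norm_mul]
        exact (mul_le_mul_of_nonneg_left (hM₁₂ x hx) (norm_nonneg _)).trans (le_max_left _ _))
      (fun x hx => by
        rw [norm_mul]
        exact (mul_le_mul_of_nonneg_left (hM₂₁ x hx) (norm_nonneg _)).trans (le_max_right _ _))
      (Or.inr ⟨mul_ne_zero (norm_pos_iff.1 hb01) (norm_pos_iff.1 hz0), le_rfl⟩)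
    refine h.trans_lt (lt_of_lt_of_le ?_ (hcG z hzp))
    refine mul_lt_mul_of_pos_right ?_ (lt_max_of_lt_left (Real.exp_pos _))
    refine lt_of_eq_of_lt ?_ hz1
    rw [hS, norm_mul]
    ring

theorem isAsymptoticallySeparated_of_tendsto {b γ : Fin 2 → ℂ} (hb : ∀ j, b j ≠ 0)
    (him : (b 0 * (b 1)⁻¹).im ≠ 0) {l : ℤ × Fin 2 → ℂ}
    (hl : Tendsto (fun p => l p - unperturbedZero b γ p) cofinite (𝓝 0)) :
    IsAsymptoticallySeparated l := by
  obtain ⟨δ, N, hδ, hsep⟩ := exists_eventually_separated_unperturbedZero (γ := γ) hb him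
  have hfin : {p | ¬ ‖l p - unperturbedZero b γ p‖ < δ / 4}.Finite := by
    have := (tendsto_zero_iff_norm_tendsto_zero.1 hl).eventually
      (gt_mem_nhds (by positivity : (0 : ℝ) < δ / 4))
    rwa [eventually_cofinite] at this
  obtain ⟨K, hK⟩ := (hfin.image fun p => |p.1|.toNat).bddAbove
  -- Of the distance `δ` between unperturbed zeros, two errors below `δ / 4` leave more than `2 * (δ
  -- / 4)`.
  refine ⟨max N K, δ / 4, by positivity, ?_⟩
  have hclose : ∀ p : ℤ × Fin 2, ((max N K : ℕ) : ℤ) < |p.1| →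
      (N : ℤ) < |p.1| ∧ ‖l p - unperturbedZero b γ p‖ < δ / 4 := by
    intro p hp
    rw [Nat.cast_max] at hp
    refine ⟨(le_max_left _ _).trans_lt hp, ?_⟩
    by_contra h
    have h1 := hK (mem_image_of_mem _ h)
    have h2 := (le_max_right (N : ℤ) K).trans_lt hp
    omega
  rintro ⟨p, hp⟩ ⟨q, hq⟩ hpq
  obtain ⟨hp1, hp2⟩ := hclose p hp
  obtain ⟨-, hq2⟩ := hclose q hq
  have h := hsep p q (fun h => hpq (Subtype.ext h)) hp1
  have h1 : unperturbedZero b γ p - unperturbedZero b γ q =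
    (l p - l q) - (l p - unperturbedZero b γ p) + (l q - unperturbedZero b γ q) := by ring
  have h2 := norm_add_le ((l p - l q) - (l p - unperturbedZero b γ p))
    (l q - unperturbedZero b γ q)
  have h3 := norm_sub_le (l p - l q) (l p - unperturbedZero b γ p)
  rw [← h1] at h2
  simp only
  linarith

/-- If an entire function has uniformly separated zeros, then so has every entire function that is
dominated off small discs around these zeros. -/
theorem IsZeroSequence.isSeparatedFamily_of_norm_sub_lt {ι : Type*} {f F : ℂ → ℂ} {l₀ : ι → ℂ}
    (hl₀ : IsZeroSequence f l₀) {δ : ℝ} (hδ : 0 < δ) (hsep : ∀ p q, p ≠ q → 4 * δ ≤ ‖l₀ p - l₀ q‖)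
    (hdom : ∀ z, (∀ p, δ ≤ ‖z - l₀ p‖) → ‖F z - f z‖ < ‖f z‖) {κ : Type*} {l : κ → ℂ}
    (hl : IsZeroSequence F l) : IsSeparatedFamily l := by
  have hzero : ∀ k, F (l k) = 0 := fun k => by
    by_contra h
    have h1 := hl.2 (l k)
    rw [(hl.1.analyticAt _).analyticOrderAt_eq_zero.2 h, encard_eq_zero] at h1
    exact (h1 ▸ (rfl : l k = l k) : k ∈ (∅ : Set κ))
  have hnear : ∀ k, ∃ p, ‖l k - l₀ p‖ < δ := fun k => by
    by_contra! h
    have h1 := hdom _ h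
    rw [hzero, zero_sub, norm_neg] at h1
    exact lt_irrefl _ h1
  choose P hP using hnear
  refine ⟨δ, hδ, fun k m hkm => ?_⟩
  by_cases hkmP : P k = P m
  -- Two listed zeros in one disc would both be its single zero, which is simple and so is listed
  -- once.
  · exfalso
    obtain ⟨w, -, hw⟩ := hl₀.exists_simple_zero_of_norm_sub_lt hl.1 (p := P k) hδ
      (fun q hq => by linarith [hsep _ q hq]) (fun z hz => hdom z fun q => by
        rw [mem_sphere_iff_norm] at hz
        by_cases hq : P k = q
        · rw [← hq, hz]
        · have h1 := hsep _ q hq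
          have h2 := norm_sub_le_norm_sub_add_norm_sub (l₀ (P k)) z (l₀ q)
          rw [norm_sub_rev (l₀ (P k)) z, hz] at h2
          linarith)
    have hmem : ∀ j, P j = P k → l j = w ∧ {i | l i = l j}.encard = 1 := fun j hj => by
      have h1 := hw (l j) (mem_ball_iff_norm.2 (hj ▸ hP j))
      have h2 : analyticOrderAt F (l j) ≠ 0 :=
        (hl.1.analyticAt _).analyticOrderAt_ne_zero.2 (hzero j)
      split_ifs at h1 with h3
      · exact ⟨h3.symm, (hl.2 _).trans h1⟩
      · exact absurd h1 h2
    obtain ⟨hk, hk1⟩ := hmem k rfl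
    obtain ⟨hm, -⟩ := hmem m hkmP.symm
    obtain ⟨i, hi⟩ := encard_eq_one.1 hk1
    have h1 : k ∈ ({i} : Set κ) := hi ▸ (rfl : l k = l k)
    have h2 : m ∈ ({i} : Set κ) := hi ▸ (hm.trans hk.symm : l m = l k)
    exact hkm ((mem_singleton_iff.1 h1).trans (mem_singleton_iff.1 h2).symm)
  · have h1 := hsep _ _ hkmP
    have h2 : l₀ (P k) - l₀ (P m) = (l k - l m) - (l k - l₀ (P k)) + (l m - l₀ (P m)) := by ring
    have h3 := norm_add_le ((l k - l m) - (l k - l₀ (P k))) (l m - l₀ (P m))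
    have h4 := norm_sub_le (l k - l m) (l k - l₀ (P k))
    rw [← h2] at h3
    linarith [hP k, hP m]

theorem exists_isSeparatedFamily_of_potentialNorm_lt {b d γ : Fin 2 → ℂ} (hb : ∀ j, b j ≠ 0)
    (him : (b 0 * (b 1)⁻¹).im ≠ 0) (hγ : ∀ j, (γ j).re ∈ Ico (0 : ℝ) 1)
    (hd : ∀ j, d j = Complex.exp (-2 * Real.pi * I * γ j)) (hS : SeparationCondition b γ) :
    ∃ C : ℝ, 0 < C ∧ ∀ q₁₂ q₂₁ : ℝ → ℂ,
      HasAnalyticContinuation q₁₂ → HasAnalyticContinuation q₂₁ → potentialNorm q₁₂ q₂₁ < C →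
      ∀ l : ℤ × Fin 2 → ℂ, IsZeroSequence (quasiPeriodicDet b d q₁₂ q₂₁) l →
        IsSeparatedFamily l := by
  obtain ⟨δ, hδ, hsep⟩ := exists_separated_unperturbedZero hb him
    (hS.unperturbedZero_injective hb him hγ)
  obtain ⟨c, hc, hcG⟩ := exists_le_norm_unperturbedDet hb hd (by positivity : 0 < δ / 4)
  -- `M` bounds the entries of `B Q`. It is fixed before the potential, and the constant of the
  -- theorem is read off from `‖b j * q‖ ≤ M`.
  obtain ⟨M, hMc, hM0⟩ : ∃ M : ℝ,
      (‖d 0‖ + ‖d 1‖) * ((M + 1) * (M * Real.exp M)) < c ∧ 0 < M := by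
    have hcont : Continuous fun M : ℝ => (‖d 0‖ + ‖d 1‖) * ((M + 1) * (M * Real.exp M)) := by
      fun_prop
    have h : ∀ᶠ M in 𝓝 (0 : ℝ), (‖d 0‖ + ‖d 1‖) * ((M + 1) * (M * Real.exp M)) < c :=
      hcont.continuousAt.eventually_lt continuousAt_const (by simpa using hc)
    exact ((h.filter_mono nhdsWithin_le_nhds).and self_mem_nhdsWithin).exists (f := 𝓝[>] (0 : ℝ))
  have hbpos : ∀ j, 0 < ‖b j‖ := fun j => norm_pos_iff.2 (hb j)
  refine ⟨min (M / ‖b 0‖) (M / ‖b 1‖), lt_min (div_pos hM0 (hbpos 0)) (div_pos hM0 (hbpos 1)),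
    fun q₁₂ q₂₁ h₁₂ h₂₁ hq l hl => ?_⟩
  obtain ⟨q₁₂', M₁₂, hd₁₂, hM₁₂⟩ := h₁₂.exists_hasDerivWithinAt
  obtain ⟨q₂₁', M₂₁, hd₂₁, hM₂₁⟩ := h₂₁.exists_hasDerivWithinAt
  refine (isZeroSequence_unperturbedDet hb hd).isSeparatedFamily_of_norm_sub_lt
    (by positivity : 0 < δ / 4) (fun p q hpq => by linarith [hsep p q hpq]) (fun z hz => ?_) hl
  have hle : ∀ j (q : ℝ → ℂ), supNorm q ≤ M / ‖b j‖ → HasAnalyticContinuation q →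
      ∀ x ∈ Icc (0 : ℝ) 1, ‖b j * q x‖ ≤ M := fun j q h1 h2 x hx => by
    rw [norm_mul, mul_comm, ← le_div_iff₀ (hbpos j)]
    exact (h2.norm_le_supNorm hx).trans h1
  have h := norm_quasiPeriodicDet_sub_le hb d (M := M) (M' := max (‖b 0‖ * M₁₂) (‖b 1‖ * M₂₁)) z
    (hle 0 q₁₂ (((le_max_left _ _).trans hq.le).trans (min_le_left _ _)) h₁₂)
    (hle 1 q₂₁ (((le_max_right _ _).trans hq.le).trans (min_le_right _ _)) h₂₁) hd₁₂ hd₂₁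
    (fun x hx => by
      rw [norm_mul]
      exact (mul_le_mul_of_nonneg_left (hM₁₂ x hx) (norm_nonneg _)).trans (le_max_left _ _))
    (fun x hx => by
      rw [norm_mul]
      exact (mul_le_mul_of_nonneg_left (hM₂₁ x hx) (norm_nonneg _)).trans (le_max_right _ _))
    -- The alternative without derivatives, valid for every `z`, keeps the constant independent of
    -- `Q`.
    (Or.inl le_rfl)
  refine h.trans_lt (lt_of_lt_of_le ?_ (hcG z hz))
  exact mul_lt_mul_of_pos_right hMc (lt_max_of_lt_left (Real.exp_pos _))

theorem proposition3p8 (b d γ : Fin 2 → ℂ)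
    (hb : (b 0 * (b 1)⁻¹).im ≠ 0)
    (hγ : ∀ j, (γ j).re ∈ Ico (0 : ℝ) 1)
    (hd : ∀ j, d j = Complex.exp (-2 * Real.pi * I * γ j)) :
    (∀ q₁₂ q₂₁ : ℝ → ℂ, HasAnalyticContinuation q₁₂ → HasAnalyticContinuation q₂₁ →
      ∃ l : ℤ × Fin 2 → ℂ, IsZeroSequence (quasiPeriodicDet b d q₁₂ q₂₁) l ∧
        (∀ j, Tendsto (fun n : ℤ => l (n, j) - unperturbedZero b γ (n, j)) cofinite (𝓝 0)) ∧
        IsAsymptoticallySeparated l) ∧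
    (SeparationCondition b γ →
      ∃ C : ℝ, 0 < C ∧ ∀ q₁₂ q₂₁ : ℝ → ℂ,
        HasAnalyticContinuation q₁₂ → HasAnalyticContinuation q₂₁ →
        potentialNorm q₁₂ q₂₁ < C →
        ∀ l : ℤ × Fin 2 → ℂ, IsZeroSequence (quasiPeriodicDet b d q₁₂ q₂₁) l →
          IsSeparatedFamily l) := by
  have hb0 : ∀ j, b j ≠ 0 := by
    have h0 : b 0 ≠ 0 := fun h => by simp [h] at hb
    have h1 : b 1 ≠ 0 := fun h => by simp [h] at hb
    intro j
    fin_cases j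
    · exact h0
    · exact h1
  refine ⟨fun q₁₂ q₂₁ h₁₂ h₂₁ => ?_, exists_isSeparatedFamily_of_potentialNorm_lt hb0 hb hγ hd⟩
  obtain ⟨l, hl, htend⟩ := exists_quasiPeriodicDet_zeros hb0 hb hd h₁₂ h₂₁
  exact ⟨l, hl, fun j => htend.comp (Prod.mk_left_injective j).tendsto_cofinite,
    isAsymptoticallySeparated_of_tendsto hb0 hb htend⟩
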